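/- Let $q$ be a prime power. For $n\ge 0$ let $P_n$ be the transition matrix on $\{0,1,\dots,n\}$ given by \[P_n(d,r)=\mathbf 1(d+r\le n)\,q^{-(n-d-r)(n-r)}\,\frac{(q^{-(n-d)};q)_r\,(q^{-n};q)_r}{(q^{-r};q)_r},\qquad (x;q)_r=\prod_{i=0}^{r-1}(1-xq^i).\] For each even $n$ let $(X^{(n)}_i)_{i\ge 0}$ be a time homogeneous Markov chain on $\{0,1,\dots,n\}$ with transition matrix $P_n$, and let \[Y^{(n)}_t=X^{(n)}_{2\lfloor q^{n/2}(q-1)t\rfloor}-\frac n2\qquad(t\ge 0).\] Let $(Z_t)_{t\ge 0}$ be the continuous time Markov chain on $\mathbb Z$, with right-continuous paths, that jumps from $a$ to $a+1$ at rate $q^{-a}$ and from $a$ to $a-1$ at rate $q^{a}$ (and has no other jumps). Assume that $Z_0=a$ almost surely for some deterministic constant $a\in\mathbb Z$, and that $Y^{(n)}_0=a$ almost surely for all large enough even $n$. Then for all deterministic times $0<t_1<t_2<\dots<t_k$, the total variation distance between the laws of \[(Y^{(n)}_{t_1},\dots,Y^{(n)}_{t_k})\quad\text{and}\quad(Z_{t_1},\dots,Z_{t_k})\]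 tends to $0$ as $n\to\infty$ along the even integers. -/

import Mathlib

open MeasureTheory Filter Topology
open scoped NNReal ENNReal

namespace RankEvolution

/-- The finite `q`-Pochhammer symbol `(a; q)_r = ∏_{i < r} (1 - a q ^ i)`. -/
noncomputable def qPoch (a q : ℝ) (r : ℕ) : ℝ :=
  ∏ i ∈ Finset.range r, (1 - a * q ^ i)

/-- The transition matrix `P_n(d, r)` on `{0, 1, …, n}`.
The natural number subtractions are only used when `d + r ≤ n`, where they are exact. -/
noncomputable def transP (q n : ℕ) (d r : Fin (n + 1)) : ℝ :=
  if (d : ℕ) + (r : ℕ) ≤ n then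
    ((q : ℝ) ^ ((n - d - r) * (n - r) : ℕ))⁻¹ *
      (qPoch ((q : ℝ) ^ (n - d : ℕ))⁻¹ q r * qPoch ((q : ℝ) ^ n)⁻¹ q r /
        qPoch ((q : ℝ) ^ (r : ℕ))⁻¹ q r)
  else 0

/-- `X` is a time homogeneous (discrete time) Markov chain with transition matrix `P`, with an
arbitrary initial distribution, on a countable discrete state space `S`. -/
structure IsMarkovChain {Ω S : Type*} [MeasurableSpace Ω] [MeasurableSpace S]
    (P : S → S → ℝ) (μ : Measure Ω) (X : ℕ → Ω → S) : Prop where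
  measurable : ∀ i, Measurable (X i)
  law : ∀ (k : ℕ) (x : ℕ → S),
    μ.real {ω | ∀ j ≤ k, X j ω = x j} =
      μ.real {ω | X 0 ω = x 0} * ∏ j ∈ Finset.range k, P (x j) (x (j + 1))

/-- The jump times `T_0 = 0`, `T_{i+1} = inf {t > T_i : Z_t ≠ Z_{T_i}}` of a process, with
`inf ∅ = ∞`. -/
noncomputable def jumpTime {Ω S : Type*} (Z : ℝ≥0 → Ω → S) : ℕ → Ω → ℝ≥0∞
  | 0, _ => 0
  | i + 1, ω =>
      sInf ((fun t : ℝ≥0 => (t : ℝ≥0∞)) ''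
        {t : ℝ≥0 | jumpTime Z i ω < (t : ℝ≥0∞) ∧ Z t ω ≠ Z (jumpTime Z i ω).toNNReal ω})

/-- The embedded discrete time process `Z_{T_i}` (only meaningful when `T_i < ∞`). -/
noncomputable def embedded {Ω S : Type*} (Z : ℝ≥0 → Ω → S) (i : ℕ) (ω : Ω) : S :=
  Z (jumpTime Z i ω).toNNReal ω

/-- The jump probabilities `Q(a, b) / (-Q(a, a))`, `b ≠ a`, of a transition rate matrix. -/
noncomputable def jumpProb {S : Type*} [DecidableEq S] (Q : S → S → ℝ) (a b : S) : ℝ :=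
  if a = b then 0 else Q a b / (-Q a a)

/-- `Z` is a continuous time Markov chain with transition rate matrix `Q` (a matrix without
absorbing states: `Q(a, a) < 0` for all `a`), with an arbitrary initial distribution. That is, the
paths are right-continuous for the discrete topology, the embedded process is a Markov chain with
the jump probabilities of `Q`, and, given the embedded process, the holding times
`T_{j+1} - T_j` are independent exponential variables with rates `-Q(Z_{T_j}, Z_{T_j})`. -/
structure IsContinuousTimeMarkovChain {Ω S : Type*} [MeasurableSpace Ω] [MeasurableSpace S]
    [TopologicalSpace S] [DecidableEq S]
    (Q : S → S → ℝ) (μ : Measure Ω) (Z : ℝ≥0 → Ω → S) : Prop where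
  measurable : ∀ t, Measurable (Z t)
  rightCts : ∀ ω t, ContinuousWithinAt (fun s => Z s ω) (Set.Ici t) t
  law : ∀ (k : ℕ) (a : ℕ → S) (s : ℕ → ℝ≥0),
    μ.real {ω | (∀ j ≤ k, embedded Z j ω = a j) ∧
        ∀ j < k, jumpTime Z j ω + (s j : ℝ≥0∞) < jumpTime Z (j + 1) ω} =
      μ.real {ω | Z 0 ω = a 0} *
        ∏ j ∈ Finset.range k,
          (jumpProb Q (a j) (a (j + 1)) * Real.exp (Q (a j) (a j) * (s j : ℝ)))

/-- The transition rate matrix `Q_Z` on `ℤ`. -/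
noncomputable def rateZ (q : ℕ) (a b : ℤ) : ℝ :=
  if b = a + 1 then (q : ℝ) ^ (-a)
  else if b = a - 1 then (q : ℝ) ^ a
  else if b = a then -(q : ℝ) ^ a - (q : ℝ) ^ (-a)
  else 0

/-- The rescaled and recentered process `Y_t = X(2 ⌊q ^ (n / 2) (q - 1) t⌋) - n / 2` for even
`n = 2 m`. -/
noncomputable def rescaled (q m : ℕ) {Ω : Type*} (X : ℕ → Ω → Fin (2 * m + 1))
    (t : ℝ≥0) (ω : Ω) : ℤ :=
  ((X (2 * ⌊(q : ℝ) ^ m * ((q : ℝ) - 1) * (t : ℝ)⌋₊) ω : ℕ) : ℤ) - (m : ℤ)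

/-- Total variation distance `sup_A |μ(A) - ν(A)|` (over measurable sets) of two probability
measures. -/
noncomputable def tvDist {α : Type*} [MeasurableSpace α] (μ ν : Measure α) : ℝ :=
  ⨆ A : {A : Set α // MeasurableSet A}, |μ.real A.1 - ν.real A.1|

end RankEvolution

/-!
The two processes are compared through their jumps and holding times. Write `δ = timeStep q m`. In
recentered coordinates, two steps of the chain stay in `u` with probability at least
`1 - δ (q ^ u + q ^ (-u))` (`one_sub_le_twoStep_self`) and move from `u` to `u + 1` and `u - 1` with
probability at least `δ q ^ (-u) (1 - O(δ))` and `δ q ^ u (1 - O(δ))` (`le_twoStep_of_adj`).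

Only such lower bounds are needed: by Scheffé's lemma (`tendsto_tvDist_of_le_liminf`), it is enough
that, for each `b`, the limit inferior of the probabilities that the rescaled chain takes the values
`b` at the times `t` is at least the probability of the same event for the limit `Z`.

Fix the number `M` of jumps, and let `ε` be the sequence of their signs. The holding times for
which the corresponding path takes the values `b` at the times `t` form an open set
`readOut (walk a ε) t b` of `ℝ ^ M`, up to the null set where a jump occurs at one of these times.
For the discrete chain, the disjoint events of following a path with given holding times add up to
the integral over `ℝ ^ M` of a step function, which converges to the density `pathDensity` of
independent exponential holding times weighted by the jump probabilities. Fatou's lemma then bounds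
the limit inferior from below by the sum over `ε` of the integrals of `pathDensity` over `readOut`
(`sum_setLIntegral_pathDensity_le_liminf`).

For `Z`, the same density is the joint law of the path and its holding times
(`measure_pathEvent_inter`), so that the probability of the event for `Z` exceeds this sum by at
most the probability that the `M`-th jump occurs before a fixed time `T ≥ max t`
(`measure_eq_le_sum_setLIntegral`). The latter tends to zero as `M → ∞` since `Z` does not explode:
`u ↦ q ^ u + q ^ (-u)` is a Lyapunov function (`sum_rateZ_mul_exitRate_le`), and hence the Laplace
transform of the time of the `M`-th jump, evaluated at `q`, tends to zero (`tendsto_jumpLaplace`).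
-/

namespace RankEvolution

/-! ### The transition matrix -/

lemma qPoch_succ (a q : ℝ) (r : ℕ) : qPoch a q (r + 1) = qPoch a q r * (1 - a * q ^ r) :=
  Finset.prod_range_succ _ _

lemma inv_pow_mul_pow_le_one {q : ℝ} (hq : 1 ≤ q) {n i : ℕ} (h : i ≤ n) :
    (q ^ n)⁻¹ * q ^ i ≤ 1 := by
  rw [inv_mul_le_one₀ (by positivity)]
  exact pow_le_pow_right₀ hq h

lemma qPoch_nonneg {q : ℝ} (hq : 1 ≤ q) {n r : ℕ} (h : r ≤ n) : 0 ≤ qPoch (q ^ n)⁻¹ q r := by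
  refine Finset.prod_nonneg fun i hi => sub_nonneg.2 (inv_pow_mul_pow_le_one hq ?_)
  have := Finset.mem_range.1 hi
  omega

lemma qPoch_le_one {q : ℝ} (hq : 1 ≤ q) {n r : ℕ} (h : r ≤ n) : qPoch (q ^ n)⁻¹ q r ≤ 1 := by
  refine Finset.prod_le_one (fun i hi => sub_nonneg.2 (inv_pow_mul_pow_le_one hq ?_)) fun i _ => ?_
  · have := Finset.mem_range.1 hi
    omega
  · have : 0 ≤ (q ^ n)⁻¹ * q ^ i := by positivity
    linarith

lemma qPoch_pos {q : ℝ} (hq : 1 < q) {n r : ℕ} (h : r ≤ n) : 0 < qPoch (q ^ n)⁻¹ q r := by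
  refine Finset.prod_pos fun i hi => sub_pos.2 ?_
  rw [inv_mul_lt_one₀ (by positivity)]
  exact pow_lt_pow_right₀ hq (by have := Finset.mem_range.1 hi; omega)

/-- The union bound `∏ (1 - xᵢ) ≥ 1 - ∑ xᵢ` for the geometric sequence in a Pochhammer symbol. -/
lemma one_sub_le_qPoch {q : ℝ} (hq : 1 < q) {n r : ℕ} (h : r ≤ n) :
    1 - (q ^ n)⁻¹ * q ^ r / (q - 1) ≤ qPoch (q ^ n)⁻¹ q r := by
  have hq1 : 0 < q - 1 := by linarith
  have key : ∀ r ≤ n, 1 - (q ^ n)⁻¹ * (q ^ r - 1) / (q - 1) ≤ qPoch (q ^ n)⁻¹ q r := by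
    intro r
    induction r with
    | zero => simp [qPoch]
    | succ r ih =>
      intro hr
      have h1 := ih (by omega)
      have h2 := qPoch_le_one hq.le (n := n) (r := r) (by omega)
      have h3 : 0 ≤ (q ^ n)⁻¹ * q ^ r := by positivity
      have h4 : 1 - (q ^ n)⁻¹ * (q ^ (r + 1) - 1) / (q - 1) =
          1 - (q ^ n)⁻¹ * (q ^ r - 1) / (q - 1) - (q ^ n)⁻¹ * q ^ r := by
        field_simp
        ring
      rw [qPoch_succ, h4]
      nlinarith
  refine le_trans ?_ (key r h)
  gcongr
  linarith

lemma transP_of_add_eq {q n : ℕ} (hq : 2 ≤ q) (d r : Fin (n + 1)) (h : (d : ℕ) + r = n) :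
    transP q n d r = qPoch ((q : ℝ) ^ n)⁻¹ q r := by
  have hq' : (1 : ℝ) < q := by exact_mod_cast (by omega : 1 < q)
  have h1 : n - (d : ℕ) = r := by omega
  have h2 := (qPoch_pos hq' (le_refl (r : ℕ))).ne'
  rw [transP, if_pos h.le, h1]
  rw [Nat.sub_self, zero_mul, pow_zero, inv_one, one_mul, mul_div_cancel_left₀ _ h2]

/-- The two Pochhammer symbols with bases `q ^ (-(r + 1))` and `q ^ (-r)` telescope. -/
lemma qPoch_succ_base {q : ℝ} (hq : 1 < q) (r : ℕ) :
    qPoch (q ^ (r + 1))⁻¹ q r * (1 - q⁻¹) = (1 - (q ^ (r + 1))⁻¹) * qPoch (q ^ r)⁻¹ q r := by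
  have hq0 : q ≠ 0 := by positivity
  have h1 : qPoch (q ^ (r + 1))⁻¹ q (r + 1) = qPoch (q ^ (r + 1))⁻¹ q r * (1 - q⁻¹) := by
    rw [qPoch_succ]
    congr 2
    field_simp
    ring
  have h2 : qPoch (q ^ (r + 1))⁻¹ q (r + 1) = (1 - (q ^ (r + 1))⁻¹) * qPoch (q ^ r)⁻¹ q r := by
    rw [qPoch, qPoch, Finset.prod_range_succ', mul_comm]
    congr 1
    · simp
    · refine Finset.prod_congr rfl fun i _ => ?_
      congr 1
      field_simp
      ring
  rw [← h1, h2]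

lemma transP_of_add_succ_eq {q n : ℕ} (hq : 2 ≤ q) (d r : Fin (n + 1)) (h : (d : ℕ) + r + 1 = n) :
    transP q n d r = ((q : ℝ) ^ (d : ℕ))⁻¹ / (q - 1) * (1 - ((q : ℝ) ^ (r + 1 : ℕ))⁻¹) *
      qPoch ((q : ℝ) ^ n)⁻¹ q r := by
  have hq' : (1 : ℝ) < q := by exact_mod_cast (by omega : 1 < q)
  have hq0 : (q : ℝ) ≠ 0 := by positivity
  have hq1 : (q : ℝ) - 1 ≠ 0 := by linarith
  have h0 : n - (d : ℕ) = r + 1 := by omega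
  have h1 : n - (d : ℕ) - r = 1 := by omega
  have h3 : n - (r : ℕ) = d + 1 := by omega
  have h2 := (qPoch_pos hq' (le_refl (r : ℕ))).ne'
  have h4 := qPoch_succ_base hq' r
  have h5 : qPoch ((q : ℝ) ^ (r + 1 : ℕ))⁻¹ q r =
      (1 - ((q : ℝ) ^ (r + 1 : ℕ))⁻¹) * qPoch ((q : ℝ) ^ (r : ℕ))⁻¹ q r * (q / (q - 1)) := by
    rw [← h4]
    field_simp
  rw [transP, if_pos (by omega), h1, h0, h3, h5]
  simp only [one_mul, pow_succ]
  generalize qPoch ((q : ℝ) ^ (r : ℕ))⁻¹ q r = y at h2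
  generalize qPoch ((q : ℝ) ^ n)⁻¹ q r = z
  field_simp

/-- The time step `δ` of the rescaled process: one step of the two-step chain is `δ` units of
time. -/
noncomputable def timeStep (q m : ℕ) : ℝ := ((q : ℝ) ^ m * ((q : ℝ) - 1))⁻¹

lemma timeStep_pos {q : ℕ} (hq : 2 ≤ q) (m : ℕ) : 0 < timeStep q m := by
  have hq' : (1 : ℝ) < q := by exact_mod_cast (by omega : 1 < q)
  have : (0 : ℝ) < q - 1 := by linarith
  unfold timeStep
  positivity

lemma tendsto_timeStep {q : ℕ} (hq : 2 ≤ q) : Tendsto (timeStep q) atTop (𝓝 0) := by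
  have hq' : (1 : ℝ) < q := by exact_mod_cast (by omega : 1 < q)
  have h1 : (0 : ℝ) < q - 1 := by linarith
  exact tendsto_inv_atTop_zero.comp
    ((tendsto_pow_atTop_atTop_of_one_lt hq').atTop_mul_const h1)

/-- The total jump rate `q ^ u + q ^ (-u)` out of `u`. -/
noncomputable def exitRate (q : ℕ) (u : ℤ) : ℝ := (q : ℝ) ^ u + (q : ℝ) ^ (-u)

lemma exitRate_pos {q : ℕ} (hq : 2 ≤ q) (u : ℤ) : 0 < exitRate q u := by
  have : (0 : ℝ) < q := by exact_mod_cast (by omega : 0 < q)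
  unfold exitRate
  positivity

lemma rateZ_self (q : ℕ) (u : ℤ) : rateZ q u u = -exitRate q u := by
  simp only [rateZ, exitRate, left_eq_add, one_ne_zero, if_false, if_true]
  rw [if_neg (by omega)]
  ring

/-- The state of the original chain corresponding to the recentered state `u`
(arbitrary for `|u| > m`). -/
def centered (m : ℕ) (u : ℤ) : Fin (2 * m + 1) := Fin.ofNat (2 * m + 1) (m + u).toNat

lemma coe_centered {m : ℕ} {u : ℤ} (h : |u| ≤ m) : ((centered m u : ℕ) : ℤ) = m + u := by
  have := abs_le.1 h
  rw [centered, Fin.val_ofNat, Nat.mod_eq_of_lt (by omega)]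
  omega

/-- The probability that two steps of the original chain lead from `u` to `v` through
the intermediate state `-max u v` (in recentered coordinates). For `|u - v| ≤ 1` this is the
dominant contribution to the two-step transition probability. -/
noncomputable def twoStep (q m : ℕ) (u v : ℤ) : ℝ :=
  transP q (2 * m) (centered m u) (centered m (-max u v)) *
    transP q (2 * m) (centered m (-max u v)) (centered m v)

lemma inv_pow_centered {q m : ℕ} (hq : 2 ≤ q) {u : ℤ} (h : |u| ≤ m) :
    ((q : ℝ) ^ (centered m u : ℕ))⁻¹ / (q - 1) = timeStep q m * (q : ℝ) ^ (-u) := by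
  have hq0 : (q : ℝ) ≠ 0 := by exact_mod_cast (by omega : q ≠ 0)
  rw [← zpow_natCast, coe_centered h, zpow_add₀ hq0, timeStep, zpow_neg, zpow_natCast,
    mul_inv, mul_inv]
  ring

/-- In recentered coordinates, `qPoch (q ^ n)⁻¹ q (n - d)` is the probability of the dominant step
`d ↦ n - d` of the original chain; this bounds it from below. -/
lemma one_sub_le_qPoch_centered {q m : ℕ} (hq : 2 ≤ q) {u : ℤ} (h : |u| ≤ m) :
    1 - timeStep q m * (q : ℝ) ^ u ≤ qPoch ((q : ℝ) ^ (2 * m))⁻¹ q (centered m u : ℕ) := by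
  have hq' : (1 : ℝ) < q := by exact_mod_cast (by omega : 1 < q)
  have hq0 : (q : ℝ) ≠ 0 := by positivity
  refine le_trans (le_of_eq ?_) (one_sub_le_qPoch hq' (by omega))
  congr 1
  rw [← zpow_natCast (q : ℝ) (centered m u : ℕ), coe_centered h, zpow_add₀ hq0, timeStep,
    two_mul, pow_add, zpow_natCast, mul_inv, mul_inv]
  field_simp

lemma one_sub_le_twoStep_self {q m : ℕ} (hq : 2 ≤ q) {u : ℤ} (h : |u| ≤ m) :
    1 - timeStep q m * exitRate q u ≤ twoStep q m u u := by
  have hq' : (1 : ℝ) < q := by exact_mod_cast (by omega : 1 < q)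
  have h' : |-u| ≤ m := by rwa [abs_neg]
  have e := coe_centered h
  have e' := coe_centered h'
  rw [twoStep, max_self, transP_of_add_eq hq _ _ (by omega), transP_of_add_eq hq _ _ (by omega)]
  have a1 := one_sub_le_qPoch_centered hq h
  have a2 := one_sub_le_qPoch_centered hq h'
  have b1 := qPoch_le_one hq'.le (n := 2 * m) (r := centered m u) (by omega)
  have b2 := qPoch_le_one hq'.le (n := 2 * m) (r := centered m (-u)) (by omega)
  rw [exitRate]
  nlinarith

/-- The common shape of the two nearest neighbour transitions: one of the two steps of the original
chain accounts for the first factor, and the other one is a dominant step, whose probability is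
the `qPoch` factor. Jumps from `u` to `u - 1` reduce to this by the symmetry `u ↦ -u`. -/
lemma le_transP_mul_qPoch {q m : ℕ} (hq : 2 ≤ q) {u v w : ℤ} (hu : |u| ≤ m) (hv : |v| ≤ m)
    (hw : |w| ≤ m) (h : v = u + 1) :
    timeStep q m * (q : ℝ) ^ (-u) * (1 - timeStep q m * (exitRate q v + exitRate q w)) ≤
      transP q (2 * m) (centered m u) (centered m (-v)) *
        qPoch ((q : ℝ) ^ (2 * m))⁻¹ q (centered m w : ℕ) := by
  have hq' : (1 : ℝ) < q := by exact_mod_cast (by omega : 1 < q)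
  have hq0 : (q : ℝ) ≠ 0 := by positivity
  have h' : |-v| ≤ m := by rwa [abs_neg]
  have e := coe_centered hu
  have e' := coe_centered h'
  have e'' := coe_centered hw
  rw [transP_of_add_succ_eq hq _ _ (by omega), inv_pow_centered hq hu]
  have a1 := one_sub_le_qPoch_centered hq hw
  have a2 := one_sub_le_qPoch_centered hq h'
  have b1 := qPoch_le_one hq'.le (n := 2 * m) (r := centered m w) (by omega)
  have b2 := qPoch_le_one hq'.le (n := 2 * m) (r := centered m (-v)) (by omega)
  have c1 := qPoch_nonneg hq'.le (n := 2 * m) (r := centered m w) (by omega)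
  have c2 := qPoch_nonneg hq'.le (n := 2 * m) (r := centered m (-v)) (by omega)
  have d1 : ((q : ℝ) ^ ((centered m (-v) : ℕ) + 1))⁻¹ ≤ timeStep q m * (q : ℝ) ^ v := by
    have := inv_pow_centered hq h'
    rw [neg_neg] at this
    rw [← this, pow_succ, mul_inv, div_eq_mul_inv]
    have : (0 : ℝ) < q - 1 := by linarith
    gcongr
    linarith
  have d2 : 0 ≤ ((q : ℝ) ^ ((centered m (-v) : ℕ) + 1))⁻¹ := by positivity
  have d3 : ((q : ℝ) ^ ((centered m (-v) : ℕ) + 1))⁻¹ ≤ 1 :=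
    inv_le_one_of_one_le₀ (one_le_pow₀ hq'.le)
  have f : 0 ≤ timeStep q m * (q : ℝ) ^ (-u) := by
    have := timeStep_pos hq m
    positivity
  have g : 0 ≤ timeStep q m * (q : ℝ) ^ (-w) := by
    have := timeStep_pos hq m
    positivity
  rw [mul_assoc (timeStep q m * (q : ℝ) ^ (-u)), mul_assoc (timeStep q m * (q : ℝ) ^ (-u))]
  refine mul_le_mul_of_nonneg_left ?_ f
  rw [exitRate, exitRate]
  set A := qPoch ((q : ℝ) ^ (2 * m))⁻¹ q (centered m w : ℕ)
  set B := qPoch ((q : ℝ) ^ (2 * m))⁻¹ q (centered m (-v) : ℕ)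
  set x := ((q : ℝ) ^ ((centered m (-v) : ℕ) + 1))⁻¹
  have h1 : A + B - 1 ≤ B * A := by nlinarith
  have h2 : B * A ≤ 1 := by nlinarith
  have h3 : (1 - x) * B * A = B * A - x * (B * A) := by ring
  have h4 : x * (B * A) ≤ x := by nlinarith
  nlinarith

lemma le_twoStep_of_adj {q m : ℕ} (hq : 2 ≤ q) {u v : ℤ} (hu : |u| ≤ m) (hv : |v| ≤ m)
    (h : v = u + 1 ∨ v = u - 1) :
    timeStep q m * (rateZ q u v * (1 - 2 * timeStep q m * (exitRate q u + exitRate q v))) ≤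
      twoStep q m u v := by
  have hq0 : (0 : ℝ) < q := by exact_mod_cast (by omega : 0 < q)
  have e := coe_centered hu
  have e' := coe_centered hv
  have t0 := timeStep_pos hq m
  have r1 := exitRate_pos hq u
  have r2 := exitRate_pos hq v
  rcases h with h | h
  · have hv' : |-v| ≤ m := by rwa [abs_neg]
    have e'' := coe_centered hv'
    rw [twoStep, max_eq_right (by omega), transP_of_add_eq hq (centered m (-v)) _ (by omega)]
    refine le_trans ?_ (le_transP_mul_qPoch hq hu hv hv h)
    rw [rateZ, if_pos h, mul_assoc (timeStep q m)]
    refine mul_le_mul_of_nonneg_left (mul_le_mul_of_nonneg_left ?_ (by positivity)) t0.le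
    nlinarith
  · have hu' : |-u| ≤ m := by rwa [abs_neg]
    have hv' : |-v| ≤ m := by rwa [abs_neg]
    have e'' := coe_centered hu'
    have key := le_transP_mul_qPoch hq hu' hv' hu' (by omega)
    rw [twoStep, max_eq_left (by omega), transP_of_add_eq hq (centered m u) _ (by omega)]
    simp only [neg_neg] at key
    refine le_trans ?_ (key.trans_eq (mul_comm _ _))
    have hx : ∀ x, exitRate q (-x) = exitRate q x := fun x => by simp [exitRate, add_comm]
    rw [rateZ, if_neg (by omega), if_pos h, mul_assoc (timeStep q m), hx, hx]
    refine mul_le_mul_of_nonneg_left (mul_le_mul_of_nonneg_left ?_ (by positivity)) t0.le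
    nlinarith

/-! ### Jump paths with prescribed holding times -/

/-- The partial sum `x 0 + ⋯ + x (j - 1)` of a finite sequence, extended by zero. -/
def psum {R : Type*} [AddCommMonoid R] {M : ℕ} (x : Fin M → R) (j : ℕ) : R :=
  ∑ l ∈ Finset.range j, if hl : l < M then x ⟨l, hl⟩ else 0

section psum

variable {R : Type*} [AddCommMonoid R] {M : ℕ}

@[simp] lemma psum_zero (x : Fin M → R) : psum x 0 = 0 := by simp [psum]

lemma psum_succ (x : Fin M → R) (j : Fin M) : psum x (j + 1) = psum x j + x j := by
  simp [psum, Finset.sum_range_succ]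

lemma psum_eq_sum (x : Fin M → R) : psum x M = ∑ j, x j := by
  rw [psum, Finset.sum_range]
  simp

lemma psum_map {R' : Type*} [AddCommMonoid R'] (f : R →+ R') (x : Fin M → R) (j : ℕ) :
    psum (fun l => f (x l)) j = f (psum x j) := by
  rw [psum, psum, map_sum]
  refine Finset.sum_congr rfl fun l _ => ?_
  split_ifs <;> simp

lemma psum_mono (x : Fin M → ℕ) : Monotone (psum x) := by
  refine monotone_nat_of_le_succ fun j => ?_
  simp [psum, Finset.sum_range_succ]

/-- Partial sums up to `M` only depend on the first `M` terms. -/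
lemma psum_snoc (x : Fin M → R) (y : R) {j : ℕ} (hj : j ≤ M) :
    psum (Fin.snoc x y : Fin (M + 1) → R) j = psum x j := by
  refine Finset.sum_congr rfl fun l hl => ?_
  have hl := Finset.mem_range.1 hl
  rw [dif_pos (by omega), dif_pos (by omega)]
  exact Fin.snoc_castSucc (α := fun _ => R) y x ⟨l, by omega⟩

end psum

/-- The jump `1` or `-1` encoded by a Boolean. -/
def sgn (e : Bool) : ℤ := if e then 1 else -1

lemma sgn_injective : Function.Injective sgn := by decide

lemma sgn_ne_zero (e : Bool) : sgn e ≠ 0 := by revert e; decide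

/-- The nearest neighbour path started at `a` with `M` jumps `ε`, constant after the last jump. -/
def walk {M : ℕ} (a : ℤ) (ε : Fin M → Bool) (j : ℕ) : ℤ := a + psum (fun l => sgn (ε l)) j

section walk

variable {M : ℕ} (a : ℤ) (ε : Fin M → Bool)

@[simp] lemma walk_zero : walk a ε 0 = a := by simp [walk]

lemma walk_succ (j : Fin M) : walk a ε (j + 1) = walk a ε j + sgn (ε j) := by
  rw [walk, psum_succ, walk, add_assoc]

lemma walk_ne_succ (j : Fin M) : walk a ε j ≠ walk a ε (j + 1) := by
  rw [walk_succ]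
  have := sgn_ne_zero (ε j)
  omega

lemma walk_snoc (e : Bool) {j : ℕ} (hj : j ≤ M) :
    walk a (Fin.snoc ε e : Fin (M + 1) → Bool) j = walk a ε j := by
  have h : (fun l => sgn ((Fin.snoc ε e : Fin (M + 1) → Bool) l)) =
      (Fin.snoc (fun l => sgn (ε l)) (sgn e) : Fin (M + 1) → ℤ) := by
    funext l
    refine Fin.lastCases ?_ (fun l => ?_) l <;> simp
  rw [walk, h, psum_snoc _ _ hj, walk]

lemma walk_snoc_succ (e : Bool) :
    walk a (Fin.snoc ε e : Fin (M + 1) → Bool) (M + 1) = walk a ε M + sgn e := by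
  have h := walk_succ a (Fin.snoc ε e : Fin (M + 1) → Bool) (Fin.last M)
  rw [Fin.val_last, walk_snoc a ε e le_rfl, Fin.snoc_last] at h
  exact h

lemma abs_walk_le (j : ℕ) : |walk a ε j| ≤ |a| + M := by
  refine (abs_add_le _ _).trans ?_
  gcongr
  have h : ∀ j : ℕ, |psum (fun l => sgn (ε l)) j| ≤ (min j M : ℕ) := by
    intro j
    induction j with
    | zero => simp
    | succ j ih =>
      rcases lt_or_ge j M with hj | hj
      · have h := psum_succ (fun l => sgn (ε l)) ⟨j, hj⟩
        rw [h]
        refine (abs_add_le _ _).trans ?_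
        have h2 : |sgn (ε ⟨j, hj⟩)| ≤ 1 := by
          generalize ε ⟨j, hj⟩ = e
          revert e
          decide
        have h3 : min (j + 1) M = min j M + 1 := by omega
        rw [h3, Nat.cast_add, Nat.cast_one]
        exact add_le_add ih h2
      · have h : psum (fun l => sgn (ε l)) (j + 1) = psum (fun l => sgn (ε l)) j := by
          rw [psum, Finset.sum_range_succ, dif_neg (by omega), add_zero, psum]
        rw [h]
        refine ih.trans ?_
        exact_mod_cast (by omega)
  refine (h j).trans ?_
  exact_mod_cast min_le_right _ _

end walk

/-- The discrete time path that visits `α 0, …, α M` in this order and spends `γ j + 1` units of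
time in `α j` for `j < M`. -/
def timePath {M : ℕ} (α : ℕ → ℤ) (γ : Fin M → ℕ) (i : ℕ) : ℤ :=
  α (Finset.univ.filter fun l : Fin M => psum (fun j => γ j + 1) (l + 1) ≤ i).card

section timePath

variable {M : ℕ} (α : ℕ → ℤ) (γ : Fin M → ℕ)

lemma timePath_eq_of_mem {i : ℕ} (j : Fin M) (h₁ : psum (fun j => γ j + 1) j ≤ i)
    (h₂ : i < psum (fun j => γ j + 1) (j + 1)) : timePath α γ i = α j := by
  have h : (Finset.univ.filter fun l : Fin M => psum (fun j => γ j + 1) (l + 1) ≤ i) =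
      Finset.Iio j := by
    ext l
    simp only [Finset.mem_filter, Finset.mem_univ, true_and, Finset.mem_Iio, Fin.lt_def]
    constructor
    · intro hl
      by_contra hlj
      have := psum_mono (fun j => γ j + 1) (by omega : (j : ℕ) + 1 ≤ l + 1)
      omega
    · intro hl
      exact (psum_mono (fun j => γ j + 1) (by omega : (l : ℕ) + 1 ≤ j)).trans h₁
  rw [timePath, h, Fin.card_Iio]

lemma timePath_psum {j : ℕ} (hj : j ≤ M) :
    timePath α γ (psum (fun j => γ j + 1) j) = α j := by
  rcases hj.lt_or_eq with hj | rfl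
  · refine timePath_eq_of_mem α γ ⟨j, hj⟩ le_rfl ?_
    have := psum_succ (fun j => γ j + 1) ⟨j, hj⟩
    simp only at this ⊢
    omega
  · rw [timePath, Finset.filter_true_of_mem]
    · simp
    · exact fun l _ => psum_mono _ (by omega)

lemma timePath_zero : timePath α γ 0 = α 0 := by
  simpa using timePath_psum α γ (Nat.zero_le M)

/-- The weight of a path, written in terms of its holding times. -/
lemma prod_timePath (K : ℤ → ℤ → ℝ) :
    ∏ i ∈ Finset.range (psum (fun j => γ j + 1) M),
        K (timePath α γ i) (timePath α γ (i + 1)) =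
      ∏ j : Fin M, (K (α j) (α j) ^ γ j * K (α j) (α (j + 1))) := by
  have key : ∀ j ≤ M, ∏ i ∈ Finset.range (psum (fun j => γ j + 1) j),
        K (timePath α γ i) (timePath α γ (i + 1)) =
      ∏ l ∈ Finset.range j, if hl : l < M then
        K (α l) (α l) ^ γ ⟨l, hl⟩ * K (α l) (α (l + 1)) else 1 := by
    intro j
    induction j with
    | zero => simp
    | succ j ih =>
      intro hj
      have h := psum_succ (fun j => γ j + 1) ⟨j, hj⟩
      have h' := timePath_psum α γ hj
      simp only at h
      rw [h] at h' ⊢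
      rw [Finset.prod_range_add, ih (by omega), Finset.prod_range_succ _ j,
        dif_pos (show j < M from hj), Finset.prod_range_succ _ (γ _)]
      congr 1
      have hmem : ∀ i ≤ γ ⟨j, hj⟩, timePath α γ (psum (fun j => γ j + 1) j + i) = α j :=
        fun i hi => timePath_eq_of_mem α γ ⟨j, hj⟩ (by simp) (by rw [h]; omega)
      congr 1
      · rw [← Finset.card_range (γ ⟨j, hj⟩), ← Finset.prod_const]
        refine Finset.prod_congr (by simp) fun i hi => ?_
        have hi := Finset.mem_range.1 hi
        rw [hmem i (by omega), add_assoc, hmem (i + 1) (by omega)]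
      · rw [hmem _ le_rfl, add_assoc, h']
  rw [key M le_rfl, Finset.prod_range]
  simp

/-- A path determines its jumps and its holding times. -/
lemma timePath_unique {α' : ℕ → ℤ} {γ' : Fin M → ℕ} (hα : ∀ j : Fin M, α j ≠ α (j + 1))
    (hα' : ∀ j : Fin M, α' j ≠ α' (j + 1))
    (h : ∀ i, i ≤ psum (fun j => γ j + 1) M → i ≤ psum (fun j => γ' j + 1) M →
      timePath α γ i = timePath α' γ' i) :
    γ = γ' ∧ ∀ j ≤ M, α j = α' j := by
  have key : ∀ j ≤ M, psum (fun j => γ j + 1) j = psum (fun j => γ' j + 1) j ∧ α j = α' j := by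
    intro j
    induction j with
    | zero =>
      intro _
      simpa [timePath_zero] using h 0 (Nat.zero_le _) (Nat.zero_le _)
    | succ j ih =>
      intro hj
      obtain ⟨h1, h2⟩ := ih (by omega)
      have e := psum_succ (fun j => γ j + 1) ⟨j, hj⟩
      have e' := psum_succ (fun j => γ' j + 1) ⟨j, hj⟩
      have l := psum_mono (fun j => γ j + 1) hj
      have l' := psum_mono (fun j => γ' j + 1) hj
      have t := timePath_psum α γ hj
      have t' := timePath_psum α' γ' hj
      have n := hα ⟨j, hj⟩
      have n' := hα' ⟨j, hj⟩
      simp only at *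
      have h3 : psum (fun j => γ j + 1) (j + 1) = psum (fun j => γ' j + 1) (j + 1) := by
        rcases lt_trichotomy (psum (fun j => γ j + 1) (j + 1))
          (psum (fun j => γ' j + 1) (j + 1)) with hlt | heq | hgt
        · have s := h _ l (hlt.le.trans l')
          rw [t, timePath_eq_of_mem α' γ' ⟨j, hj⟩ (by simp only; omega) hlt] at s
          exact absurd (h2.trans s.symm) n
        · exact heq
        · have s := h _ (hgt.le.trans l) l'
          rw [t', timePath_eq_of_mem α γ ⟨j, hj⟩ (by simp only; omega) hgt] at s
          exact absurd (h2.symm.trans s) n'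
      refine ⟨h3, ?_⟩
      rw [← t, ← t', ← h3]
      exact h _ l (h3.le.trans l')
  refine ⟨funext fun j => ?_, fun j hj => (key j hj).2⟩
  have e := psum_succ (fun j => γ j + 1) j
  have e' := psum_succ (fun j => γ' j + 1) j
  have h1 := (key j j.2.le).1
  have h2 := (key (j + 1) j.2).1
  omega

end timePath

/-- The holding times `h` for which the path that spends time `h j` in `α j` is in state `b i` at
time `t i` for all `i`, and does not jump at any of the times `t i`. -/
def readOut {M k : ℕ} (α : ℕ → ℤ) (t : Fin k → ℝ≥0) (b : Fin k → ℤ) : Set (Fin M → ℝ) :=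
  {h | ∀ i, ∃ j : Fin M, psum h j < t i ∧ (t i : ℝ) < psum h (j + 1) ∧ α j = b i}

/-! ### Lower bounds for the discrete time chain -/

lemma centered_injOn {m : ℕ} {u v : ℤ} (hu : |u| ≤ m) (hv : |v| ≤ m)
    (h : centered m u = centered m v) :
    u = v := by
  have e := coe_centered hu
  have e' := coe_centered hv
  rw [h] at e
  omega

/-- If the two-step chain follows a path whose rescaled holding times lie in `readOut`, then the
rescaled process passes through the prescribed states. -/
lemma rescaled_eq_of_mem_readOut {q m : ℕ} {Ω : Type*} {X : ℕ → Ω → Fin (2 * m + 1)} {M k : ℕ}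
    (hq : 2 ≤ q) {α : ℕ → ℤ} (hα : ∀ j, |α j| ≤ m)
    {γ : Fin M → ℕ} {t : Fin k → ℝ≥0} {b : Fin k → ℤ}
    (h : (fun j => timeStep q m * ((γ j : ℝ) + 1)) ∈ readOut α t b) {ω : Ω}
    (hω : ∀ i ≤ psum (fun j => γ j + 1) M, X (2 * i) ω = centered m (timePath α γ i))
    (i : Fin k) : rescaled q m X (t i) ω = b i := by
  obtain ⟨j, h1, h2, h3⟩ := h i
  have hδ := timeStep_pos hq m
  have hs : ∀ l, psum (fun j => timeStep q m * ((γ j : ℝ) + 1)) l =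
      timeStep q m * (psum (fun j => γ j + 1) l : ℕ) := by
    intro l
    have := psum_map ((AddMonoidHom.mulLeft (timeStep q m)).comp (Nat.castAddMonoidHom ℝ))
      (fun j => γ j + 1) l
    simpa using this
  rw [hs] at h1 h2
  have e : (q : ℝ) ^ m * ((q : ℝ) - 1) * (t i : ℝ) = (timeStep q m)⁻¹ * t i := by
    rw [timeStep, inv_inv]
  have h1' : (psum (fun j => γ j + 1) j : ℕ) ≤ ⌊(q : ℝ) ^ m * ((q : ℝ) - 1) * (t i : ℝ)⌋₊ := by
    refine Nat.le_floor ?_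
    rw [e, ← div_eq_inv_mul, le_div_iff₀ hδ, mul_comm]
    exact h1.le
  have h2' : ⌊(q : ℝ) ^ m * ((q : ℝ) - 1) * (t i : ℝ)⌋₊ < psum (fun j => γ j + 1) (j + 1) := by
    rw [Nat.floor_lt (by rw [e]; positivity), e, ← div_eq_inv_mul, div_lt_iff₀ hδ, mul_comm]
    exact h2
  rw [rescaled, hω _ (h2'.le.trans (psum_mono _ j.2)), timePath_eq_of_mem α γ j h1' h2',
    coe_centered (hα j), h3]
  ring

section chain

variable {q m : ℕ} {Ω : Type*} [MeasurableSpace Ω] {μ : Measure Ω} [IsProbabilityMeasure μ]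
  {X : ℕ → Ω → Fin (2 * m + 1)}

lemma prod_twoStep_le (hX : IsMarkovChain (transP q (2 * m)) μ X) (w : ℕ → ℤ)
    (hX0 : ∀ᵐ ω ∂μ, X 0 ω = centered m (w 0)) (G : ℕ) :
    ∏ i ∈ Finset.range G, twoStep q m (w i) (w (i + 1)) ≤
      μ.real {ω | ∀ i ≤ G, X (2 * i) ω = centered m (w i)} := by
  set x : ℕ → Fin (2 * m + 1) := fun n =>
    if n % 2 = 0 then centered m (w (n / 2)) else centered m (-max (w (n / 2)) (w (n / 2 + 1)))
    with hx
  have h0 : ∀ i, x (2 * i) = centered m (w i) := fun i => by simp [hx]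
  have h1 : ∀ i, x (2 * i + 1) = centered m (-max (w i) (w (i + 1))) := fun i => by
    have e1 : (2 * i + 1) % 2 = 1 := by omega
    have e2 : (2 * i + 1) / 2 = i := by omega
    simp [hx, e1, e2]
  have hprod : ∏ j ∈ Finset.range (2 * G), transP q (2 * m) (x j) (x (j + 1)) =
      ∏ i ∈ Finset.range G, twoStep q m (w i) (w (i + 1)) := by
    induction G with
    | zero => simp
    | succ G ih =>
      rw [show 2 * (G + 1) = 2 * G + 1 + 1 by ring, Finset.prod_range_succ,
        Finset.prod_range_succ, ih, Finset.prod_range_succ, mul_assoc, twoStep, h0, h1,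
        show 2 * G + 1 + 1 = 2 * (G + 1) by ring, h0]
  have hstart : μ.real {ω | X 0 ω = x 0} = 1 := by
    have h := h0 0
    rw [mul_zero] at h
    rw [← probReal_univ (μ := μ)]
    refine measureReal_congr ?_
    filter_upwards [hX0] with ω hω
    exact eq_true (hω.trans h.symm)
  have h := hX.law (2 * G) x
  rw [hprod, hstart, one_mul] at h
  rw [← h]
  refine measureReal_mono fun ω hω i hi => ?_
  rw [hω (2 * i) (by omega), h0]

/-- Decomposition over the jumps `ε` and the holding times `γ + 1`: the corresponding events for
the two-step chain are disjoint. -/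
lemma tsum_prod_twoStep_le {M k : ℕ} (hq : 2 ≤ q) {a : ℤ} (ham : |a| + M ≤ m)
    (hX : IsMarkovChain (transP q (2 * m)) μ X) (hX0 : ∀ᵐ ω ∂μ, X 0 ω = centered m a)
    (t : Fin k → ℝ≥0) (b : Fin k → ℤ) :
    ∑ ε : Fin M → Bool, ∑' γ : Fin M → ℕ,
        (readOut (walk a ε) t b).indicator
          (fun _ => ENNReal.ofReal (∏ j : Fin M, (twoStep q m (walk a ε j) (walk a ε j) ^ γ j *
            twoStep q m (walk a ε j) (walk a ε (j + 1)))))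
          (fun j => timeStep q m * ((γ j : ℝ) + 1)) ≤
      μ {ω | ∀ i, rescaled q m X (t i) ω = b i} := by
  have hα : ∀ (ε : Fin M → Bool) j, |walk a ε j| ≤ m := fun ε j => (abs_walk_le a ε j).trans ham
  have hT : ∀ (ε : Fin M → Bool) (γ : Fin M → ℕ) i, |timePath (walk a ε) γ i| ≤ m :=
    fun ε γ i => hα ε _
  set C : (Fin M → Bool) × (Fin M → ℕ) → Set Ω := fun p =>
    {ω | ∀ i ≤ psum (fun j => p.2 j + 1) M, X (2 * i) ω = centered m (timePath (walk a p.1) p.2 i)}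
    with hC
  set good : (Fin M → Bool) × (Fin M → ℕ) → Prop := fun p =>
    (fun j => timeStep q m * ((p.2 j : ℝ) + 1)) ∈ readOut (walk a p.1) t b with hgood
  set E : (Fin M → Bool) × (Fin M → ℕ) → Set Ω := fun p => {ω | good p ∧ ω ∈ C p} with hE
  have hmeasC : ∀ p, MeasurableSet (C p) := by
    intro p
    have : C p = ⋂ i, ⋂ (_ : i ≤ psum (fun j => p.2 j + 1) M),
        X (2 * i) ⁻¹' {centered m (timePath (walk a p.1) p.2 i)} := by
      ext ω
      simp [hC]
    rw [this]
    exact MeasurableSet.iInter fun i => MeasurableSet.iInter fun _ =>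
      hX.measurable _ (measurableSet_singleton _)
  have hmeas : ∀ p, MeasurableSet (E p) := fun p => by
    by_cases h : good p
    · simpa [hE, h] using hmeasC p
    · simp [hE, h]
  have hdisj : Pairwise (Function.onFun Disjoint E) := by
    intro p p' hne
    refine Set.disjoint_left.2 fun ω hω hω' => hne ?_
    have h := timePath_unique (walk a p.1) p.2 (α' := walk a p'.1) (γ' := p'.2)
      (walk_ne_succ a p.1) (walk_ne_succ a p'.1) fun i h1 h2 =>
        centered_injOn (hT _ _ _) (hT _ _ _) ((hω.2 i h1).symm.trans (hω'.2 i h2))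
    refine Prod.ext (funext fun j => sgn_injective ?_) h.1
    have h1 := h.2 j j.2.le
    have h2 := h.2 (j + 1) j.2
    rw [walk_succ, walk_succ, h1] at h2
    exact add_left_cancel h2
  calc _ ≤ ∑ ε : Fin M → Bool, ∑' γ : Fin M → ℕ, μ (E (ε, γ)) := by
        refine Finset.sum_le_sum fun ε _ => ENNReal.tsum_le_tsum fun γ => ?_
        by_cases h : good (ε, γ)
        · rw [Set.indicator_of_mem h, ← prod_timePath]
          have h1 := prod_twoStep_le hX (timePath (walk a ε) γ)
            (by simpa [timePath_zero] using hX0) (psum (fun j => γ j + 1) M)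
          have h2 : E (ε, γ) = C (ε, γ) := by simp [hE, h]
          rw [h2, ← ofReal_measureReal]
          exact ENNReal.ofReal_le_ofReal h1
        · rw [Set.indicator_of_notMem h]
          exact zero_le
    _ = ∑' p, μ (E p) := by
        rw [ENNReal.tsum_prod', tsum_fintype]
    _ ≤ μ (⋃ p, E p) := tsum_meas_le_meas_iUnion_of_disjoint μ hmeas hdisj
    _ ≤ _ := by
        refine measure_mono (Set.iUnion_subset fun p ω hω i => ?_)
        exact rescaled_eq_of_mem_readOut hq (hα p.1) hω.1 hω.2 i

end chain

/-! ### Passage to the limit -/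

/-- The sub-probability density of the holding time in `u` on the event that the next state
is `v`. -/
noncomputable def holdDensity {S : Type*} (Q : S → S → ℝ) (u v : S) (x : ℝ) : ℝ≥0∞ :=
  (Set.Ici 0).indicator (fun x => ENNReal.ofReal (Q u v * Real.exp (Q u u * x))) x

/-- The joint density of the holding times along the path `α 0, …, α M`, on the event that
the process started in `α 0` follows this path. -/
noncomputable def pathDensity {S : Type*} (Q : S → S → ℝ) {M : ℕ} (α : ℕ → S) (h : Fin M → ℝ) :
    ℝ≥0∞ :=
  ∏ j : Fin M, holdDensity Q (α j) (α (j + 1)) (h j)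

lemma measurable_holdDensity {S : Type*} (Q : S → S → ℝ) (u v : S) :
    Measurable (holdDensity Q u v) := by
  unfold holdDensity
  exact Measurable.indicator (by fun_prop) measurableSet_Ici

lemma continuous_psum {M : ℕ} (j : ℕ) : Continuous fun h : Fin M → ℝ => psum h j := by
  unfold psum
  refine continuous_finsetSum _ fun l _ => ?_
  split_ifs with h
  · exact continuous_apply _
  · exact continuous_const

lemma isOpen_readOut {M k : ℕ} (α : ℕ → ℤ) (t : Fin k → ℝ≥0) (b : Fin k → ℤ) :
    IsOpen (readOut (M := M) α t b) := by
  have : readOut (M := M) α t b = ⋂ i, ⋃ j : Fin M, {h : Fin M → ℝ | psum h j < t i} ∩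
      {h | (t i : ℝ) < psum h (j + 1)} ∩ {_h | α j = b i} := by
    ext h
    simp [readOut, and_assoc]
  rw [this]
  exact isOpen_iInter_of_finite fun i => isOpen_iUnion fun j =>
    ((isOpen_lt (continuous_psum _) continuous_const).inter
      (isOpen_lt continuous_const (continuous_psum _))).inter isOpen_const

lemma tendsto_one_sub_timeStep_rpow {q : ℕ} (hq : 2 ≤ q) (lam x : ℝ) :
    Tendsto (fun m => (1 - timeStep q m * lam) ^ (x / timeStep q m)) atTop
      (𝓝 (Real.exp (-lam * x))) := by
  have h0 := tendsto_timeStep hq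
  have h1 : Tendsto (fun m => (timeStep q m)⁻¹) atTop atTop :=
    tendsto_inv_nhdsGT_zero.comp (tendsto_nhdsWithin_iff.2
      ⟨h0, Eventually.of_forall fun m => timeStep_pos hq m⟩)
  have h2 := ((Real.tendsto_one_add_div_rpow_exp (-lam)).comp h1).rpow_const (p := x)
    (Or.inl (Real.exp_pos _).ne')
  rw [← Real.exp_mul] at h2
  refine h2.congr' ?_
  have h3 : ∀ᶠ m in atTop, timeStep q m * lam < 1 := by
    have := h0.mul_const lam
    rw [zero_mul] at this
    exact this.eventually (gt_mem_nhds one_pos)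
  filter_upwards [h3] with m hm
  have e : 1 + -lam / (timeStep q m)⁻¹ = 1 - timeStep q m * lam := by
    rw [div_inv_eq_mul]
    ring
  simp only [Function.comp_apply]
  rw [e, ← Real.rpow_mul (by linarith), div_eq_inv_mul]

lemma walk_adj {M : ℕ} (a : ℤ) (ε : Fin M → Bool) (j : Fin M) :
    walk a ε (j + 1) = walk a ε j + 1 ∨ walk a ε (j + 1) = walk a ε j - 1 := by
  rw [walk_succ]
  cases ε j
  · exact Or.inr rfl
  · exact Or.inl rfl

lemma rateZ_nonneg_of_adj {q : ℕ} {u v : ℤ} (h : v = u + 1 ∨ v = u - 1) :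
    0 ≤ rateZ q u v := by
  rcases h with h | h
  · rw [rateZ, if_pos h]
    positivity
  · rw [rateZ, if_neg (by omega), if_pos h]
    positivity

/-- The weight of the block in which the two-step chain stays for `γ` steps in `u` and then moves
to `v` dominates a discretization of the limiting density. -/
lemma le_twoStep_pow_mul {q m : ℕ} (hq : 2 ≤ q) {u v : ℤ} (hu : |u| ≤ m) (hv : |v| ≤ m)
    (huv : v = u + 1 ∨ v = u - 1) {x : ℝ} (hx : 0 ≤ x)
    (h1 : timeStep q m * exitRate q u < 1)
    (h2 : 0 ≤ 1 - 2 * timeStep q m * (exitRate q u + exitRate q v)) :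
    (1 - timeStep q m * exitRate q u) ^ (x / timeStep q m) *
        (rateZ q u v * (1 - 2 * timeStep q m * (exitRate q u + exitRate q v))) ≤
      (timeStep q m)⁻¹ * (twoStep q m u u ^ ⌊x / timeStep q m⌋₊ * twoStep q m u v) := by
  have hδ := timeStep_pos hq m
  have hu0 := exitRate_pos hq u
  have s1 := one_sub_le_twoStep_self hq hu
  have s2 := le_twoStep_of_adj hq hu hv huv
  have h0 : 0 < 1 - timeStep q m * exitRate q u := by linarith
  have s3 : (1 - timeStep q m * exitRate q u) ^ (x / timeStep q m) ≤
      twoStep q m u u ^ ⌊x / timeStep q m⌋₊ := by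
    refine le_trans ?_ (pow_le_pow_left₀ h0.le s1 _)
    rw [← Real.rpow_natCast]
    exact Real.rpow_le_rpow_of_exponent_ge h0 (by nlinarith) (Nat.floor_le (by positivity))
  have s4 : rateZ q u v * (1 - 2 * timeStep q m * (exitRate q u + exitRate q v)) ≤
      (timeStep q m)⁻¹ * twoStep q m u v := by
    rwa [← div_eq_inv_mul, le_div_iff₀ hδ, mul_comm]
  have s5 : 0 ≤ (1 - timeStep q m * exitRate q u) ^ (x / timeStep q m) := by positivity
  have s6 : 0 ≤ (timeStep q m)⁻¹ * twoStep q m u v :=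
    (mul_nonneg (rateZ_nonneg_of_adj huv) h2).trans s4
  calc _ ≤ (1 - timeStep q m * exitRate q u) ^ (x / timeStep q m) *
        ((timeStep q m)⁻¹ * twoStep q m u v) := mul_le_mul_of_nonneg_left s4 s5
    _ ≤ twoStep q m u u ^ ⌊x / timeStep q m⌋₊ * ((timeStep q m)⁻¹ * twoStep q m u v) :=
        mul_le_mul_of_nonneg_right s3 s6
    _ = _ := by ring

/-- A sum over holding times, as an integral of a step function. -/
lemma lintegral_floor_eq_tsum {M : ℕ} {δ : ℝ} (hδ : 0 < δ) (F : (Fin M → ℕ) → ℝ≥0∞) :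
    ∫⁻ h in Set.univ.pi fun _ : Fin M => Set.Ici (0 : ℝ),
        F (fun j => ⌊h j / δ⌋₊) / ENNReal.ofReal δ ^ M = ∑' γ, F γ := by
  have hκ : Measurable fun (h : Fin M → ℝ) (j : Fin M) => ⌊h j / δ⌋₊ :=
    measurable_pi_lambda _ fun j =>
      Nat.measurable_floor.comp (by fun_prop)
  have hδ0 : ENNReal.ofReal δ ^ M ≠ 0 := pow_ne_zero _ (by simpa using hδ)
  have hδt : ENNReal.ofReal δ ^ M ≠ ⊤ := ENNReal.pow_ne_top ENNReal.ofReal_ne_top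
  rw [← lintegral_map (f := fun γ => F γ / ENNReal.ofReal δ ^ M)
    (g := fun (h : Fin M → ℝ) (j : Fin M) => ⌊h j / δ⌋₊) (by fun_prop) hκ, lintegral_countable']
  refine tsum_congr fun γ => ?_
  rw [Measure.map_apply hκ (measurableSet_singleton γ),
    Measure.restrict_apply (hκ (measurableSet_singleton γ))]
  have : ((fun (h : Fin M → ℝ) (j : Fin M) => ⌊h j / δ⌋₊) ⁻¹' {γ} ∩
      Set.univ.pi fun _ : Fin M => Set.Ici (0 : ℝ)) =
      Set.univ.pi fun j => Set.Ico (γ j * δ) ((γ j + 1) * δ) := by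
    ext h
    simp only [Set.mem_inter_iff, Set.mem_preimage, Set.mem_singleton_iff, Set.mem_univ_pi,
      Set.mem_Ici, Set.mem_Ico, funext_iff, ← forall_and]
    refine forall_congr' fun j => ⟨fun ⟨h1, h2⟩ => ?_, fun ⟨h1, h2⟩ => ?_⟩
    · rw [Nat.floor_eq_iff (by positivity), le_div_iff₀ hδ, div_lt_iff₀ hδ] at h1
      exact h1
    · have h0 : 0 ≤ h j := le_trans (by positivity) h1
      refine ⟨?_, h0⟩
      rw [Nat.floor_eq_iff (by positivity), le_div_iff₀ hδ, div_lt_iff₀ hδ]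
      exact ⟨h1, h2⟩
  rw [this, volume_pi_pi]
  have e : ∀ j, volume (Set.Ico (γ j * δ) ((γ j + 1) * δ)) = ENNReal.ofReal δ := fun j => by
    rw [Real.volume_Ico]
    congr 1
    ring
  simp only [e, Finset.prod_const, Finset.card_univ, Fintype.card_fin]
  exact ENNReal.div_mul_cancel hδ0 hδt

lemma tendsto_timeStep_mul_floor {q : ℕ} (hq : 2 ≤ q) {x : ℝ} (hx : 0 ≤ x) :
    Tendsto (fun m => timeStep q m * ((⌊x / timeStep q m⌋₊ : ℝ) + 1)) atTop (𝓝 x) := by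
  have h0 := tendsto_timeStep hq
  refine tendsto_of_tendsto_of_tendsto_of_le_of_le (tendsto_const_nhds (x := x))
    (by simpa using h0.const_add x) (fun m => ?_) fun m => ?_
  · have hδ := timeStep_pos hq m
    have := (Nat.lt_floor_add_one (x / timeStep q m)).le
    rwa [div_le_iff₀ hδ, mul_comm] at this
  · have hδ := timeStep_pos hq m
    have := Nat.floor_le (a := x / timeStep q m) (by positivity)
    rw [le_div_iff₀ hδ] at this
    simp only
    linarith

/-- Fatou's lemma: for a fixed sequence of jumps, the weight of the paths of the rescaled two-step
chain with given values at the times `t` is asymptotically at least its continuous counterpart. -/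
lemma setLIntegral_pathDensity_le_liminf {q M k : ℕ} (hq : 2 ≤ q) (a : ℤ) (ε : Fin M → Bool)
    (t : Fin k → ℝ≥0) (b : Fin k → ℤ) :
    ∫⁻ h in readOut (walk a ε) t b, pathDensity (M := M) (rateZ q) (walk a ε) h ≤
      liminf (fun m => ∑' γ : Fin M → ℕ,
        (readOut (walk a ε) t b).indicator
          (fun _ => ENNReal.ofReal (∏ j : Fin M, (twoStep q m (walk a ε j) (walk a ε j) ^ γ j *
            twoStep q m (walk a ε j) (walk a ε (j + 1)))))
          (fun j => timeStep q m * ((γ j : ℝ) + 1))) atTop := by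
  set U := readOut (M := M) (walk a ε) t b with hU
  have hUo : IsOpen U := isOpen_readOut _ _ _
  set F : ℕ → (Fin M → ℕ) → ℝ≥0∞ := fun m γ => U.indicator
          (fun _ => ENNReal.ofReal (∏ j : Fin M, (twoStep q m (walk a ε j) (walk a ε j) ^ γ j *
            twoStep q m (walk a ε j) (walk a ε (j + 1)))))
          (fun j => timeStep q m * ((γ j : ℝ) + 1)) with hF
  set pos : Set (Fin M → ℝ) := Set.univ.pi fun _ => Set.Ici 0
  have hpos : MeasurableSet pos := MeasurableSet.univ_pi fun _ => measurableSet_Ici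
  have hδ0 := tendsto_timeStep hq
  -- pointwise lower bound; openness of `U` keeps the discretized holding times inside `U`
  have key : ∀ h ∈ pos, U.indicator (pathDensity (rateZ q) (walk a ε)) h ≤
      liminf (fun m => F m (fun j => ⌊h j / timeStep q m⌋₊) /
        ENNReal.ofReal (timeStep q m) ^ M) atTop := by
    intro h hh
    have hh0 : ∀ j, 0 ≤ h j := fun j => hh j trivial
    by_cases hhU : h ∈ U
    swap
    · rw [Set.indicator_of_notMem hhU]
      exact zero_le
    rw [Set.indicator_of_mem hhU]
    set L : ℕ → ℝ := fun m => ∏ j : Fin M,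
      ((1 - timeStep q m * exitRate q (walk a ε j)) ^ (h j / timeStep q m) *
        (rateZ q (walk a ε j) (walk a ε (j + 1)) * (1 - 2 * timeStep q m *
          (exitRate q (walk a ε j) + exitRate q (walk a ε (j + 1)))))) with hL
    have hlim : Tendsto (fun m => ENNReal.ofReal (L m)) atTop
        (𝓝 (pathDensity (rateZ q) (walk a ε) h)) := by
      have e : pathDensity (rateZ q) (walk a ε) h = ENNReal.ofReal (∏ j : Fin M,
          (Real.exp (-exitRate q (walk a ε j) * h j) *
            rateZ q (walk a ε j) (walk a ε (j + 1)))) := by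
        rw [pathDensity, ENNReal.ofReal_prod_of_nonneg fun j _ =>
          mul_nonneg (Real.exp_pos _).le (rateZ_nonneg_of_adj (walk_adj a ε j))]
        refine Finset.prod_congr rfl fun j _ => ?_
        rw [holdDensity, Set.indicator_of_mem (show h j ∈ Set.Ici 0 from hh0 j), rateZ_self,
          mul_comm]
      rw [e]
      refine (ENNReal.continuous_ofReal.tendsto _).comp (tendsto_finsetProd _ fun j _ => ?_)
      refine (tendsto_one_sub_timeStep_rpow hq _ _).mul ?_
      have := ((hδ0.const_mul 2).mul_const
        (exitRate q (walk a ε j) + exitRate q (walk a ε (j + 1)))).const_sub 1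
      simpa using this.const_mul (rateZ q (walk a ε j) (walk a ε (j + 1)))
    have hmem : ∀ᶠ m in atTop,
        (fun j => timeStep q m * ((⌊h j / timeStep q m⌋₊ : ℝ) + 1)) ∈ U :=
      (tendsto_pi_nhds.2 fun j => tendsto_timeStep_mul_floor hq (hh0 j)).eventually
        (hUo.mem_nhds hhU)
    have hsmall : ∀ᶠ m in atTop, ∀ j : Fin M,
        timeStep q m * exitRate q (walk a ε j) < 1 ∧ 0 ≤ 1 - 2 * timeStep q m *
          (exitRate q (walk a ε j) + exitRate q (walk a ε (j + 1))) := by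
      refine eventually_all.2 fun j => Eventually.and ?_ ?_
      · have := hδ0.mul_const (exitRate q (walk a ε j))
        rw [zero_mul] at this
        exact this.eventually (gt_mem_nhds one_pos)
      · have := ((hδ0.const_mul 2).mul_const
          (exitRate q (walk a ε j) + exitRate q (walk a ε (j + 1)))).const_sub 1
        rw [mul_zero, zero_mul, sub_zero] at this
        exact this.eventually (le_mem_nhds one_pos)
    rw [← hlim.liminf_eq]
    -- eventually, the step function is at least `L`, which converges to the density
    refine liminf_le_liminf ?_
    filter_upwards [hmem, hsmall, eventually_ge_atTop (a.natAbs + M)] with m h1 h2 h3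
    have hw : ∀ j, |walk a ε j| ≤ m := fun j => (abs_walk_le a ε j).trans (by
      rw [Int.abs_eq_natAbs]
      omega)
    have hδ := timeStep_pos hq m
    simp only [hF]
    rw [Set.indicator_of_mem h1, ENNReal.le_div_iff_mul_le
      (Or.inl (pow_ne_zero _ (by simpa using hδ)))
      (Or.inl (ENNReal.pow_ne_top ENNReal.ofReal_ne_top)), ← ENNReal.ofReal_pow hδ.le,
      ← ENNReal.ofReal_mul' (by positivity)]
    refine ENNReal.ofReal_le_ofReal ?_
    have hprod : L m ≤ ∏ j : Fin M, ((timeStep q m)⁻¹ * (twoStep q m (walk a ε j) (walk a ε j) ^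
        ⌊h j / timeStep q m⌋₊ * twoStep q m (walk a ε j) (walk a ε (j + 1)))) := by
      refine Finset.prod_le_prod (fun j _ => ?_) fun j _ =>
        le_twoStep_pow_mul hq (hw _) (hw _) (walk_adj a ε j) (hh0 j) (h2 j).1 (h2 j).2
      refine mul_nonneg (Real.rpow_nonneg ?_ _)
        (mul_nonneg (rateZ_nonneg_of_adj (walk_adj a ε j)) (h2 j).2)
      linarith [(h2 j).1]
    rw [Finset.prod_mul_distrib, Finset.prod_const, Finset.card_univ, Fintype.card_fin,
      inv_pow, ← div_eq_inv_mul, le_div_iff₀ (by positivity)] at hprod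
    exact hprod
  calc ∫⁻ h in U, pathDensity (rateZ q) (walk a ε) h
      = ∫⁻ h in pos, U.indicator (pathDensity (rateZ q) (walk a ε)) h := by
        rw [← lintegral_indicator hUo.measurableSet, ← lintegral_indicator hpos]
        refine lintegral_congr fun h => ?_
        by_cases hh : h ∈ pos
        · rw [Set.indicator_of_mem hh]
        · rw [Set.indicator_of_notMem hh]
          refine Set.indicator_apply_eq_zero.2 fun _ => ?_
          simp only [pos, Set.mem_univ_pi, not_forall] at hh
          obtain ⟨j, hj⟩ := hh
          exact Finset.prod_eq_zero (Finset.mem_univ j) (Set.indicator_of_notMem hj _)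
    _ ≤ ∫⁻ h in pos, liminf (fun m => F m (fun j => ⌊h j / timeStep q m⌋₊) /
          ENNReal.ofReal (timeStep q m) ^ M) atTop :=
        setLIntegral_mono' hpos key
    _ ≤ liminf (fun m => ∫⁻ h in pos, F m (fun j => ⌊h j / timeStep q m⌋₊) /
          ENNReal.ofReal (timeStep q m) ^ M) atTop := by
        refine lintegral_liminf_le fun m => ?_
        have hκ : Measurable fun (h : Fin M → ℝ) (j : Fin M) => ⌊h j / timeStep q m⌋₊ :=
          measurable_pi_lambda _ fun j =>
            Nat.measurable_floor.comp (by fun_prop)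
        exact ((measurable_of_countable (F m)).comp hκ).div_const _
    _ = liminf (fun m => ∑' γ, F m γ) atTop := by
        congr 1
        funext m
        exact lintegral_floor_eq_tsum (timeStep_pos hq m) (F m)

lemma sum_liminf_le_liminf_sum {ι : Type*} [Fintype ι] (f : ℕ → ι → ℝ≥0∞) :
    ∑ i, liminf (fun m => f m i) atTop ≤ liminf (fun m => ∑ i, f m i) atTop := by
  let _ : MeasurableSpace ι := ⊤
  have := lintegral_liminf_le (μ := Measure.count) (u := atTop) (f := f)
    fun m => measurable_from_top
  simpa [lintegral_count, tsum_fintype] using this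

/-- The asymptotic lower bound for the finite dimensional distributions of the rescaled chain. -/
lemma sum_setLIntegral_pathDensity_le_liminf {q : ℕ} (hq : 2 ≤ q) {Ω : ℕ → Type*}
    [∀ m, MeasurableSpace (Ω m)] (μ : ∀ m, Measure (Ω m)) [∀ m, IsProbabilityMeasure (μ m)]
    {X : ∀ m, ℕ → Ω m → Fin (2 * m + 1)}
    (hX : ∀ m, IsMarkovChain (transP q (2 * m)) (μ m) (X m)) {a : ℤ}
    (hY0 : ∀ᶠ m in atTop, ∀ᵐ ω ∂(μ m), rescaled q m (X m) 0 ω = a)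
    {k : ℕ} (t : Fin k → ℝ≥0) (b : Fin k → ℤ) (M : ℕ) :
    ∑ ε : Fin M → Bool, ∫⁻ h in readOut (walk a ε) t b,
        pathDensity (M := M) (rateZ q) (walk a ε) h ≤
      liminf (fun m => μ m {ω | ∀ i, rescaled q m (X m) (t i) ω = b i}) atTop := by
  refine (Finset.sum_le_sum fun ε _ =>
    setLIntegral_pathDensity_le_liminf hq a ε t b).trans ?_
  refine (sum_liminf_le_liminf_sum _).trans (liminf_le_liminf ?_)
  filter_upwards [hY0, eventually_ge_atTop (a.natAbs + M)] with m h1 h2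
  have h3 : |a| + M ≤ m := by
    rw [Int.abs_eq_natAbs]
    omega
  refine tsum_prod_twoStep_le hq h3 (hX m) ?_ t b
  filter_upwards [h1] with ω hω
  have h4 := coe_centered (m := m) (u := a) (by omega)
  simp only [rescaled, NNReal.coe_zero, mul_zero, Nat.floor_zero] at hω
  exact Fin.ext (by omega)

/-! ### Integrals of the path density -/

lemma lintegral_fin_prod {M : ℕ} (f : Fin M → ℝ → ℝ≥0∞) (hf : ∀ j, Measurable (f j)) :
    ∫⁻ h : Fin M → ℝ, ∏ j, f j (h j) = ∏ j, ∫⁻ x, f j x := by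
  induction M with
  | zero => simp [volume_pi]
  | succ M ih =>
    have hm : Measurable fun h : Fin M → ℝ => ∏ j : Fin M, f j.succ (h j) :=
      Finset.measurable_prod _ fun j _ => (hf j.succ).comp (measurable_pi_apply j)
    have hm' : Measurable fun h : Fin (M + 1) → ℝ => ∏ j, f j (h j) :=
      Finset.measurable_prod _ fun j _ => (hf j).comp (measurable_pi_apply j)
    have e := (volume_preserving_piFinSuccAbove (fun _ : Fin (M + 1) => ℝ) 0).symm
    rw [← e.lintegral_comp hm', Fin.prod_univ_succ, ← ih _ fun j => hf j.succ,
      ← lintegral_prod_mul (hf 0).aemeasurable hm.aemeasurable]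
    refine lintegral_congr fun p => ?_
    simp [Fin.prod_univ_succ, MeasurableEquiv.piFinSuccAbove]

lemma lintegral_Ioi_mul_exp {c l s : ℝ} (hc : 0 ≤ c) (hl : l < 0) :
    ∫⁻ x in Set.Ioi s, ENNReal.ofReal (c * Real.exp (l * x)) =
      ENNReal.ofReal (c / -l * Real.exp (l * s)) := by
  have h1 : Integrable (fun x => c * Real.exp (l * x)) (volume.restrict (Set.Ioi s)) := by
    refine Integrable.const_mul ?_ c
    exact integrableOn_exp_mul_Ioi hl s
  rw [← ofReal_integral_eq_lintegral_ofReal h1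
    (Eventually.of_forall fun x => mul_nonneg hc (Real.exp_pos _).le), integral_const_mul,
    integral_exp_mul_Ioi hl]
  congr 1
  field_simp

section density

variable {S : Type*} (Q : S → S → ℝ)

lemma setLIntegral_Ioi_holdDensity {u v : S} (huv : 0 ≤ Q u v) (hu : Q u u < 0) (s : ℝ) :
    ∫⁻ x in Set.Ioi s, holdDensity Q u v x =
      ENNReal.ofReal (Q u v / -Q u u * Real.exp (Q u u * (s.toNNReal : ℝ))) := by
  have h1 : ∫⁻ x in Set.Ioi s, holdDensity Q u v x =
      ∫⁻ x in Set.Ioi (s.toNNReal : ℝ), ENNReal.ofReal (Q u v * Real.exp (Q u u * x)) := by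
    rw [← lintegral_indicator measurableSet_Ioi, ← lintegral_indicator measurableSet_Ioi]
    -- the two integrands can only differ at `0`
    refine lintegral_congr_ae ?_
    filter_upwards [compl_mem_ae_iff.2 (measure_singleton (0 : ℝ))] with x hx
    have hx : x ≠ 0 := hx
    rw [Real.coe_toNNReal']
    simp only [holdDensity, Set.indicator_apply, Set.mem_Ioi, Set.mem_Ici, max_lt_iff]
    rcases lt_or_gt_of_ne hx with h | h
    · simp [h.not_ge, h.not_gt]
    · simp [h, h.le]
  rw [h1, lintegral_Ioi_mul_exp huv hu]

lemma lintegral_holdDensity_mul_exp {u v : S} (huv : 0 ≤ Q u v) (hu : Q u u < 0) {c : ℝ}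
    (hc : 0 ≤ c) :
    ∫⁻ x, holdDensity Q u v x * ENNReal.ofReal (Real.exp (-c * x)) =
      ENNReal.ofReal (Q u v / (-Q u u + c)) := by
  have h1 : ∀ x, holdDensity Q u v x * ENNReal.ofReal (Real.exp (-c * x)) =
      (Set.Ici 0).indicator
        (fun x => ENNReal.ofReal (Q u v * Real.exp ((Q u u - c) * x))) x := by
    intro x
    by_cases hx : x ∈ Set.Ici (0 : ℝ)
    swap
    · simp only [holdDensity, Set.indicator_of_notMem hx, zero_mul]
    simp only [holdDensity, Set.indicator_of_mem hx]
    rw [← ENNReal.ofReal_mul (mul_nonneg huv (Real.exp_pos _).le), mul_assoc, ← Real.exp_add]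
    congr 3
    ring
  simp_rw [h1]
  rw [lintegral_indicator measurableSet_Ici, setLIntegral_congr Ioi_ae_eq_Ici.symm,
    lintegral_Ioi_mul_exp huv (by linarith)]
  congr 1
  simp
  ring

/-- The exponential Markov inequality for the sum of the holding times. -/
lemma setLIntegral_pathDensity_psum_le {M : ℕ} (α : ℕ → S)
    (hα : ∀ j : Fin M, 0 ≤ Q (α j) (α (j + 1)) ∧ Q (α j) (α j) < 0) {c : ℝ} (hc : 0 ≤ c) (T : ℝ) :
    ∫⁻ h in {h : Fin M → ℝ | psum h M ≤ T}, pathDensity Q α h ≤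
      ENNReal.ofReal (Real.exp (c * T) *
        ∏ j : Fin M, (Q (α j) (α (j + 1)) / (-Q (α j) (α j) + c))) := by
  have hmeas : MeasurableSet {h : Fin M → ℝ | psum h M ≤ T} :=
    (isClosed_le (continuous_psum M) continuous_const).measurableSet
  calc _ ≤ ∫⁻ h in {h : Fin M → ℝ | psum h M ≤ T}, ENNReal.ofReal (Real.exp (c * T)) *
        ∏ j : Fin M, (holdDensity Q (α j) (α (j + 1)) (h j) *
          ENNReal.ofReal (Real.exp (-c * h j))) := by
        refine setLIntegral_mono' hmeas fun h hh => ?_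
        have hh : psum h M ≤ T := hh
        rw [Finset.prod_mul_distrib, ← ENNReal.ofReal_prod_of_nonneg fun j _ =>
          (Real.exp_pos _).le, ← Real.exp_sum, mul_left_comm,
          ← ENNReal.ofReal_mul (Real.exp_pos _).le, ← Real.exp_add]
        refine le_mul_of_one_le_right zero_le ?_
        rw [← ENNReal.ofReal_one]
        refine ENNReal.ofReal_le_ofReal (Real.one_le_exp ?_)
        rw [← Finset.mul_sum, ← psum_eq_sum]
        nlinarith
    _ ≤ ∫⁻ h : Fin M → ℝ, ENNReal.ofReal (Real.exp (c * T)) *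
        ∏ j : Fin M, (holdDensity Q (α j) (α (j + 1)) (h j) *
          ENNReal.ofReal (Real.exp (-c * h j))) := setLIntegral_le_lintegral _ _
    _ = _ := by
        rw [lintegral_const_mul' _ _ ENNReal.ofReal_ne_top, lintegral_fin_prod
          (fun j x => holdDensity Q (α j) (α (j + 1)) x * ENNReal.ofReal (Real.exp (-c * x)))
          fun j => (measurable_holdDensity Q _ _).mul (by fun_prop),
          ENNReal.ofReal_mul (Real.exp_pos _).le, ENNReal.ofReal_prod_of_nonneg fun j _ =>
            div_nonneg (hα j).1 (by linarith [(hα j).2])]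
        congr 1
        exact Finset.prod_congr rfl fun j _ =>
          lintegral_holdDensity_mul_exp Q (hα j).1 (hα j).2 hc

/-- The path density is the density of a product measure. -/
lemma pi_withDensity_holdDensity {M : ℕ} (α : ℕ → S)
    [∀ j : Fin M, SigmaFinite (volume.withDensity (holdDensity Q (α j) (α (j + 1))))] :
    Measure.pi (fun j : Fin M => volume.withDensity (holdDensity Q (α j) (α (j + 1)))) =
      (volume : Measure (Fin M → ℝ)).withDensity (pathDensity Q α) := by
  refine Measure.pi_eq fun s hs => ?_
  rw [withDensity_apply _ (MeasurableSet.univ_pi hs),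
    ← lintegral_indicator (MeasurableSet.univ_pi hs)]
  have h1 : ∀ h : Fin M → ℝ, (Set.univ.pi s).indicator (pathDensity Q α) h =
      ∏ j : Fin M, (s j).indicator (holdDensity Q (α j) (α (j + 1))) (h j) := by
    intro h
    by_cases hh : h ∈ Set.univ.pi s
    · rw [Set.indicator_of_mem hh, pathDensity]
      exact Finset.prod_congr rfl fun j _ => (Set.indicator_of_mem (hh j trivial) _).symm
    · rw [Set.indicator_of_notMem hh]
      simp only [Set.mem_univ_pi, not_forall] at hh
      obtain ⟨j, hj⟩ := hh
      exact (Finset.prod_eq_zero (Finset.mem_univ j) (Set.indicator_of_notMem hj _)).symm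
  simp_rw [h1]
  rw [lintegral_fin_prod (fun j : Fin M => (s j).indicator (holdDensity Q (α j) (α (j + 1))))
    fun j => (measurable_holdDensity Q _ _).indicator (hs j)]
  refine Finset.prod_congr rfl fun j _ => ?_
  rw [lintegral_indicator (hs j), withDensity_apply _ (hs j)]

end density

/-- A measure that agrees with the path density on boxes is given by the path density. -/
lemma eq_withDensity_pathDensity {S : Type*} {Q : S → S → ℝ} {M : ℕ} {α : ℕ → S}
    (hα : ∀ j : Fin M, 0 ≤ Q (α j) (α (j + 1)) ∧ Q (α j) (α j) < 0) {ρ : Measure (Fin M → ℝ)}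
    (hρ : ∀ s : Fin M → ℝ, ρ (Set.univ.pi fun j => Set.Ioi (s j)) =
      ENNReal.ofReal (∏ j : Fin M, (Q (α j) (α (j + 1)) / -Q (α j) (α j) *
        Real.exp (Q (α j) (α j) * ((s j).toNNReal : ℝ))))) :
    ρ = volume.withDensity (pathDensity Q α) := by
  have hIoi : ∀ (j : Fin M) (x : ℝ),
      volume.withDensity (holdDensity Q (α j) (α (j + 1))) (Set.Ioi x) =
        ENNReal.ofReal (Q (α j) (α (j + 1)) / -Q (α j) (α j) *
          Real.exp (Q (α j) (α j) * (x.toNNReal : ℝ))) := fun j x => by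
    rw [withDensity_apply _ measurableSet_Ioi,
      setLIntegral_Ioi_holdDensity Q (hα j).1 (hα j).2]
  have hspan : ∀ j : Fin M, (volume.withDensity
      (holdDensity Q (α j) (α (j + 1)))).FiniteSpanningSetsIn (Set.range Set.Ioi) := fun j =>
    { set := fun n => Set.Ioi (-(n : ℝ))
      set_mem := fun n => ⟨_, rfl⟩
      finite := fun n => by
        rw [hIoi]
        exact ENNReal.ofReal_lt_top
      spanning := by
        refine Set.iUnion_eq_univ_iff.2 fun x => ?_
        obtain ⟨n, hn⟩ := exists_nat_gt (-x)
        exact ⟨n, by simp only [Set.mem_Ioi]; linarith⟩ }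
  have : ∀ j : Fin M, SigmaFinite (volume.withDensity (holdDensity Q (α j) (α (j + 1)))) :=
    fun j => (hspan j).sigmaFinite
  rw [← pi_withDensity_holdDensity]
  refine (Measure.pi_eq_generateFrom (C := fun _ => Set.range Set.Ioi) (fun _ => ?_)
    (fun _ => isPiSystem_Ioi) hspan fun s hs => ?_).symm
  · rw [← borel_eq_generateFrom_Ioi]
    exact BorelSpace.measurable_eq.symm
  · choose x hx using hs
    obtain rfl : (fun j => Set.Ioi (x j)) = s := funext hx
    rw [hρ, ENNReal.ofReal_prod_of_nonneg fun j _ => mul_nonneg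
      (div_nonneg (hα j).1 (by linarith [(hα j).2])) (Real.exp_pos _).le]
    exact Finset.prod_congr rfl fun j _ => (hIoi j (x j)).symm

/-- Almost surely no jump occurs at a fixed positive time. -/
lemma volume_psum_eq {M : ℕ} (j : ℕ) (hj : j ≤ M) {c : ℝ} (hc : 0 < c) :
    volume {h : Fin M → ℝ | psum h j = c} = 0 := by
  cases j with
  | zero => simp [hc.ne]
  | succ j =>
    set φ : (Fin M → ℝ) →ₗ[ℝ] ℝ :=
      { toFun := fun h => psum h (j + 1)
        map_add' := fun x y => by
          simp only [psum, ← Finset.sum_add_distrib]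
          refine Finset.sum_congr rfl fun l _ => ?_
          split_ifs <;> simp
        map_smul' := fun r x => by
          simp only [psum, RingHom.id_apply, smul_eq_mul, Finset.mul_sum]
          refine Finset.sum_congr rfl fun l _ => ?_
          split_ifs <;> simp } with hφ
    have h1 : {h : Fin M → ℝ | psum h (j + 1) = c} =
        ((AffineSubspace.mk' c ⊥).comap φ.toAffineMap : AffineSubspace ℝ (Fin M → ℝ)) := by
      ext h
      simp [hφ, AffineSubspace.mem_mk', sub_eq_zero]
    rw [h1]
    refine Measure.addHaar_affineSubspace _ _ fun htop => ?_
    have h2 : (0 : Fin M → ℝ) ∈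
        ((AffineSubspace.mk' c ⊥).comap φ.toAffineMap : AffineSubspace ℝ (Fin M → ℝ)) := by
      rw [htop]
      trivial
    simp [AffineSubspace.mem_mk'] at h2
    exact hc.ne' h2

/-! ### Jump times and holding times of a right-continuous process -/

/-- The points of the grid `(n + 1)⁻¹ ℕ` next to the right of `t` converge to `t`. -/
lemma tendsto_grid (t : ℝ≥0) :
    Tendsto (fun n : ℕ => (((⌊t * (n + 1)⌋₊ + 1 : ℕ) : ℝ≥0) / (n + 1))) atTop (𝓝[>] t) := by
  refine tendsto_nhdsWithin_iff.2 ⟨?_, Eventually.of_forall fun n => ?_⟩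
  · have h : Tendsto (fun n : ℕ => t + 1 / ((n : ℝ≥0) + 1)) atTop (𝓝 t) := by
      simpa using (tendsto_one_div_add_atTop_nhds_zero_nat (𝕜 := ℝ≥0)).const_add t
    refine tendsto_of_tendsto_of_tendsto_of_le_of_le tendsto_const_nhds h (fun n => ?_) fun n => ?_
    · simp only
      rw [le_div_iff₀ (by positivity)]
      push_cast
      exact (Nat.lt_floor_add_one _).le
    · simp only
      rw [div_le_iff₀ (by positivity), add_mul, one_div_mul_cancel (by positivity)]
      push_cast
      gcongr
      exact Nat.floor_le zero_le
  · simp only [Set.mem_Ioi]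
    rw [lt_div_iff₀ (by positivity)]
    push_cast
    exact Nat.lt_floor_add_one _

section process

variable {Ω S : Type*} {Z : ℝ≥0 → Ω → S}

lemma jumpTime_le_succ (j : ℕ) (ω : Ω) : jumpTime Z j ω ≤ jumpTime Z (j + 1) ω := by
  refine le_sInf ?_
  rintro _ ⟨t, ht, rfl⟩
  exact ht.1.le

lemma eq_embedded {j : ℕ} {ω : Ω} {t : ℝ≥0} (h1 : jumpTime Z j ω ≤ t)
    (h2 : (t : ℝ≥0∞) < jumpTime Z (j + 1) ω) : Z t ω = embedded Z j ω := by
  by_contra hne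
  rcases h1.lt_or_eq with h1 | h1
  · exact h2.not_ge (sInf_le ⟨t, ⟨h1, hne⟩, rfl⟩)
  · rw [embedded, h1] at hne
    exact hne rfl

lemma exists_jumpTime_le_lt {M : ℕ} {ω : Ω} {t : ℝ≥0} (h : (t : ℝ≥0∞) < jumpTime Z M ω) :
    ∃ j : Fin M, jumpTime Z j ω ≤ t ∧ (t : ℝ≥0∞) < jumpTime Z (j + 1) ω := by
  induction M with
  | zero => simp [jumpTime] at h
  | succ M ih =>
    by_cases h' : (t : ℝ≥0∞) < jumpTime Z M ω
    · obtain ⟨j, hj⟩ := ih h'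
      exact ⟨j.castSucc, hj⟩
    · exact ⟨Fin.last M, not_lt.1 h', h⟩

/-- The holding time in the `j`-th visited state (with junk value `0` if it is infinite). -/
noncomputable def holdingTime (Z : ℝ≥0 → Ω → S) (j : ℕ) (ω : Ω) : ℝ :=
  (jumpTime Z (j + 1) ω - jumpTime Z j ω).toReal

/-- The event that the process visits the states `α 0, …, α M` in this order (and makes at least
`M` jumps). -/
def pathEvent (Z : ℝ≥0 → Ω → S) (M : ℕ) (α : ℕ → S) : Set Ω :=
  {ω | (∀ j ≤ M, embedded Z j ω = α j) ∧ (∀ j < M, jumpTime Z j ω < jumpTime Z (j + 1) ω) ∧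
    jumpTime Z M ω < ⊤}

lemma jumpTime_lt_top {M : ℕ} {α : ℕ → S} {ω : Ω} (hω : ω ∈ pathEvent Z M α) {j : ℕ}
    (hj : j ≤ M) : jumpTime Z j ω < ⊤ :=
  (monotone_nat_of_le_succ (fun i => jumpTime_le_succ i ω) hj).trans_lt hω.2.2

lemma jumpTime_eq_psum {M : ℕ} {α : ℕ → S} {ω : Ω} (hω : ω ∈ pathEvent Z M α) {j : ℕ}
    (hj : j ≤ M) :
    (jumpTime Z j ω).toReal = psum (fun l : Fin M => holdingTime Z l ω) j := by
  induction j with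
  | zero => simp [jumpTime]
  | succ j ih =>
    have h := psum_succ (fun l : Fin M => holdingTime Z l ω) ⟨j, hj⟩
    simp only at h
    rw [h, ← ih (by omega), holdingTime,
      ENNReal.toReal_sub_of_le (jumpTime_le_succ j ω) (jumpTime_lt_top hω hj).ne]
    ring

lemma lt_holdingTime_iff {M : ℕ} {α : ℕ → S} {ω : Ω} (hω : ω ∈ pathEvent Z M α) (j : Fin M)
    (s : ℝ) : s < holdingTime Z j ω ↔
      jumpTime Z j ω + (s.toNNReal : ℝ≥0∞) < jumpTime Z (j + 1) ω := by
  have h1 := hω.2.1 j j.2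
  have h2 := (jumpTime_lt_top hω (j.2.le)).ne
  have h3 := (jumpTime_lt_top hω (j := j + 1) j.2).ne
  have h4 : 0 < holdingTime Z j ω := by
    refine ENNReal.toReal_pos (tsub_pos_of_lt h1).ne' ?_
    exact (tsub_le_self.trans_lt (lt_top_iff_ne_top.2 h3)).ne
  have h5 : holdingTime Z j ω = (jumpTime Z (j + 1) ω).toReal - (jumpTime Z j ω).toReal :=
    ENNReal.toReal_sub_of_le h1.le h3
  rw [← ENNReal.toReal_lt_toReal (ENNReal.add_ne_top.2 ⟨h2, ENNReal.coe_ne_top⟩) h3,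
    ENNReal.toReal_add h2 ENNReal.coe_ne_top, ENNReal.coe_toReal, Real.coe_toNNReal',
    ← lt_sub_iff_add_lt', ← h5, max_lt_iff]
  exact ⟨fun h => ⟨h, h4⟩, fun h => h.1⟩

variable [MeasurableSpace Ω] [MeasurableSpace S] [TopologicalSpace S] [DiscreteTopology S]
  [BorelSpace S]

/-- A right-continuous process can be evaluated at a random time: approximate the time from the
right by grid points. -/
lemma measurable_eval (hm : ∀ t, Measurable (Z t))
    (hrc : ∀ ω t, ContinuousWithinAt (fun s => Z s ω) (Set.Ici t) t) {τ : Ω → ℝ≥0}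
    (hτ : Measurable τ) : Measurable fun ω => Z (τ ω) ω := by
  refine measurable_of_tendsto_metrizable
    (f := fun (n : ℕ) ω => Z (((⌊τ ω * (n + 1)⌋₊ + 1 : ℕ) : ℝ≥0) / (n + 1)) ω) (fun n => ?_) ?_
  · have h1 : ∀ g : ℕ → ℝ≥0, Measurable fun p : ℕ × Ω => Z (g p.1) p.2 := fun g =>
      measurable_from_prod_countable_right fun i => hm (g i)
    have h2 : ∀ κ : Ω → ℕ, Measurable κ → ∀ g : ℕ → ℝ≥0, Measurable fun ω => Z (g (κ ω)) ω :=
      fun κ hκ g => (h1 g).comp (hκ.prodMk measurable_id)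
    exact h2 (fun ω => ⌊τ ω * (n + 1)⌋₊) (Nat.measurable_floor.comp (hτ.mul_const _))
      fun i => ((i + 1 : ℕ) : ℝ≥0) / (n + 1)
  · rw [tendsto_pi_nhds]
    intro ω
    exact ((hrc ω (τ ω)).mono Set.Ioi_subset_Ici_self).tendsto.comp (tendsto_grid (τ ω))

lemma measurable_jumpTime [Countable S] (hm : ∀ t, Measurable (Z t))
    (hrc : ∀ ω t, ContinuousWithinAt (fun s => Z s ω) (Set.Ici t) t) (j : ℕ) :
    Measurable (jumpTime Z j) := by
  induction j with
  | zero => exact measurable_const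
  | succ j ih =>
    have hemb : Measurable (embedded Z j) := measurable_eval hm hrc ih.ennreal_toNNReal
    refine measurable_of_Iio fun c => ?_
    -- by right-continuity, a jump before time `c` is visible at a grid point before time `c`
    have h : jumpTime Z (j + 1) ⁻¹' Set.Iio c =
        ⋃ (n : ℕ) (i : ℕ), {ω | (((((i + 1 : ℕ) : ℝ≥0) / (n + 1) : ℝ≥0) : ℝ≥0∞) < c) ∧
          jumpTime Z j ω < (((i + 1 : ℕ) : ℝ≥0) / (n + 1) : ℝ≥0) ∧
          Z (((i + 1 : ℕ) : ℝ≥0) / (n + 1)) ω ≠ embedded Z j ω} := by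
      ext ω
      simp only [Set.mem_preimage, Set.mem_Iio, Set.mem_iUnion, Set.mem_ofPred_eq]
      constructor
      · intro hω
        obtain ⟨_, ⟨t, ⟨ht1, ht2⟩, rfl⟩, htc⟩ := sInf_lt_iff.1 hω
        have hgrid := tendsto_grid t
        have e1 : ∀ᶠ s in 𝓝[>] t, Z s ω = Z t ω :=
          ((hrc ω t).mono Set.Ioi_subset_Ici_self).tendsto.eventually
            (show ∀ᶠ z in 𝓝 (Z t ω), z = Z t ω by simp [nhds_discrete])
        have e2 : ∀ᶠ s : ℝ≥0 in 𝓝[>] t, (s : ℝ≥0∞) < c :=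
          nhdsWithin_le_nhds ((ENNReal.continuous_coe.tendsto t).eventually (gt_mem_nhds htc))
        have e3 : ∀ᶠ s in 𝓝[>] t, t < s := self_mem_nhdsWithin
        obtain ⟨n, h1, h2, h3⟩ := (hgrid.eventually (e1.and (e2.and e3))).exists
        refine ⟨n, ⌊t * (n + 1)⌋₊, h2, ht1.trans (ENNReal.coe_lt_coe.2 h3), ?_⟩
        rw [h1]
        exact ht2
      · rintro ⟨n, i, h1, h2, h3⟩
        exact sInf_lt_iff.2 ⟨_, ⟨_, ⟨h2, h3⟩, rfl⟩, h1⟩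
    rw [h]
    refine MeasurableSet.iUnion fun n => MeasurableSet.iUnion fun i => ?_
    exact (MeasurableSet.const _).inter ((measurableSet_lt ih measurable_const).inter
      (measurableSet_eq_fun (hm _) hemb).compl)

end process

section law

variable {Ω S : Type*} [MeasurableSpace Ω] [MeasurableSpace S] [TopologicalSpace S]
  [DecidableEq S] {Q : S → S → ℝ} {ν : Measure Ω} {Z : ℝ≥0 → Ω → S}

/-- The holding times are almost surely finite. -/
lemma measure_jumpTime_eq_top [IsProbabilityMeasure ν]
    (hZ : IsContinuousTimeMarkovChain Q ν Z) {M : ℕ} {α : ℕ → S}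
    (hα : ∀ j < M, Q (α j) (α j) < 0) :
    ν {ω | (∀ j ≤ M, embedded Z j ω = α j) ∧ (∀ j < M, jumpTime Z j ω < jumpTime Z (j + 1) ω) ∧
      jumpTime Z M ω = ⊤} = 0 := by
  cases M with
  | zero => simp [jumpTime]
  | succ M =>
    set B := {ω | (∀ j ≤ M + 1, embedded Z j ω = α j) ∧
      (∀ j < M + 1, jumpTime Z j ω < jumpTime Z (j + 1) ω) ∧ jumpTime Z (M + 1) ω = ⊤}
    rw [← measureReal_eq_zero_iff]
    -- the law with `n` as the bound for the last holding time, and `0` for all others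
    set s : ℕ → ℕ → ℝ≥0 := fun n j => if j = M then n else 0
    set C : ℝ := ν.real {ω | Z 0 ω = α 0} *
      ((∏ j ∈ Finset.range M, jumpProb Q (α j) (α (j + 1))) * jumpProb Q (α M) (α (M + 1)))
    have hle : ∀ n : ℕ, ν.real B ≤ C * Real.exp (Q (α M) (α M) * n) := by
      intro n
      have h := hZ.law (M + 1) α (s n)
      have h2 : ∏ j ∈ Finset.range M, (jumpProb Q (α j) (α (j + 1)) *
          Real.exp (Q (α j) (α j) * (s n j : ℝ))) =
          ∏ j ∈ Finset.range M, jumpProb Q (α j) (α (j + 1)) := by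
        refine Finset.prod_congr rfl fun j hj => ?_
        have hj : j ≠ M := (Finset.mem_range.1 hj).ne
        simp [s, hj]
      rw [Finset.prod_range_succ, h2] at h
      have h3 : C * Real.exp (Q (α M) (α M) * n) = ν.real {ω | Z 0 ω = α 0} *
          ((∏ j ∈ Finset.range M, jumpProb Q (α j) (α (j + 1))) *
            (jumpProb Q (α M) (α (M + 1)) * Real.exp (Q (α M) (α M) * (s n M : ℝ)))) := by
        simp only [C, s, if_true, NNReal.coe_natCast]
        ring
      rw [h3, ← h]
      refine measureReal_mono fun ω hω => ⟨hω.1, fun j hj => ?_⟩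
      by_cases hjM : j = M
      · subst hjM
        rw [hω.2.2]
        exact ENNReal.add_lt_top.2 ⟨(hω.2.1 j hj).trans_le le_top, ENNReal.coe_lt_top⟩
      · simpa [s, hjM] using hω.2.1 j hj
    have hlim : Tendsto (fun n : ℕ => C * Real.exp (Q (α M) (α M) * n)) atTop (𝓝 (C * 0)) := by
      refine Tendsto.const_mul C (Real.tendsto_exp_atBot.comp ?_)
      exact tendsto_natCast_atTop_atTop.const_mul_atTop_of_neg (hα M (by omega))
    rw [mul_zero] at hlim
    exact le_antisymm (ge_of_tendsto' hlim hle) measureReal_nonneg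

/-- Joint survival function of the holding times on the event that the process follows a given
path. -/
lemma measure_pathEvent_inter_lt [IsProbabilityMeasure ν]
    (hZ : IsContinuousTimeMarkovChain Q ν Z) {M : ℕ} {α : ℕ → S}
    (hα : ∀ j < M, Q (α j) (α j) < 0) (h0 : ∀ᵐ ω ∂ν, Z 0 ω = α 0) (s : Fin M → ℝ) :
    ν {ω | ω ∈ pathEvent Z M α ∧ ∀ j : Fin M, s j < holdingTime Z j ω} =
      ENNReal.ofReal (∏ j : Fin M, (jumpProb Q (α j) (α (j + 1)) *
        Real.exp (Q (α j) (α j) * ((s j).toNNReal : ℝ)))) := by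
  have hstart : ν.real {ω | Z 0 ω = α 0} = 1 := by
    rw [← probReal_univ (μ := ν)]
    refine measureReal_congr ?_
    filter_upwards [h0] with ω hω
    exact eq_true hω
  set s' : ℕ → ℝ≥0 := fun j => if hj : j < M then (s ⟨j, hj⟩).toNNReal else 0 with hs'
  have hs'j : ∀ j : Fin M, s' j = (s j).toNNReal := fun j => by simp [hs']
  have h := hZ.law M α s'
  rw [hstart, one_mul, Finset.prod_range] at h
  simp only [hs'j] at h
  rw [← h, ofReal_measureReal]
  refine measure_congr ?_
  filter_upwards [compl_mem_ae_iff.2 (measure_jumpTime_eq_top hZ hα)] with ω hω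
  refine propext ⟨fun hω1 => ⟨hω1.1.1, fun j hj => ?_⟩, fun hω1 => ?_⟩
  · have := (lt_holdingTime_iff hω1.1 ⟨j, hj⟩ _).1 (hω1.2 ⟨j, hj⟩)
    rwa [← hs'j] at this
  · have hlt : ∀ j < M, jumpTime Z j ω < jumpTime Z (j + 1) ω := fun j hj =>
      le_self_add.trans_lt (hω1.2 j hj)
    have hmem : ω ∈ pathEvent Z M α :=
      ⟨hω1.1, hlt, lt_top_iff_ne_top.2 fun htop => hω ⟨hω1.1, hlt, htop⟩⟩
    refine ⟨hmem, fun j => (lt_holdingTime_iff hmem j _).2 ?_⟩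
    rw [← hs'j]
    exact hω1.2 j j.2

variable [DiscreteTopology S] [BorelSpace S] [Countable S]

lemma measurableSet_pathEvent (hZ : IsContinuousTimeMarkovChain Q ν Z) (M : ℕ) (α : ℕ → S) :
    MeasurableSet (pathEvent Z M α) := by
  have hT := measurable_jumpTime hZ.measurable hZ.rightCts
  have hE : ∀ j, Measurable (embedded Z j) := fun j =>
    measurable_eval hZ.measurable hZ.rightCts (hT j).ennreal_toNNReal
  have h1 : MeasurableSet {ω | ∀ j ≤ M, embedded Z j ω = α j} := by
    simp only [Set.ofPred_forall]
    exact MeasurableSet.iInter fun j => MeasurableSet.iInter fun _ =>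
      hE j (measurableSet_singleton _)
  have h2 : MeasurableSet {ω | ∀ j < M, jumpTime Z j ω < jumpTime Z (j + 1) ω} := by
    simp only [Set.ofPred_forall]
    exact MeasurableSet.iInter fun j => MeasurableSet.iInter fun _ =>
      measurableSet_lt (hT j) (hT (j + 1))
  exact h1.inter (h2.inter (measurableSet_lt (hT M) measurable_const))

lemma measurable_holdingTime (hZ : IsContinuousTimeMarkovChain Q ν Z) (j : ℕ) :
    Measurable (holdingTime Z j) :=
  ((measurable_jumpTime hZ.measurable hZ.rightCts (j + 1)).sub
    (measurable_jumpTime hZ.measurable hZ.rightCts j)).ennreal_toReal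

/-- The joint law of the path and its holding times has density `pathDensity`. -/
lemma measure_pathEvent_inter [IsProbabilityMeasure ν]
    (hZ : IsContinuousTimeMarkovChain Q ν Z) {M : ℕ} {α : ℕ → S}
    (hα : ∀ j : Fin M, 0 ≤ Q (α j) (α (j + 1)) ∧ Q (α j) (α j) < 0)
    (hne : ∀ j : Fin M, α j ≠ α (j + 1)) (h0 : ∀ᵐ ω ∂ν, Z 0 ω = α 0)
    {B : Set (Fin M → ℝ)} (hB : MeasurableSet B) :
    ν {ω | ω ∈ pathEvent Z M α ∧ (fun j : Fin M => holdingTime Z j ω) ∈ B} =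
      ∫⁻ h in B, pathDensity Q α h := by
  have hH : Measurable fun ω (j : Fin M) => holdingTime Z j ω :=
    measurable_pi_lambda _ fun j => measurable_holdingTime hZ j
  have key := eq_withDensity_pathDensity hα
    (ρ := (ν.restrict (pathEvent Z M α)).map fun ω (j : Fin M) => holdingTime Z j ω)
    fun s => by
      rw [Measure.map_apply hH (MeasurableSet.univ_pi fun _ => measurableSet_Ioi),
        Measure.restrict_apply (hH (MeasurableSet.univ_pi fun _ => measurableSet_Ioi)),
        Set.inter_comm]
      have e : ∀ j : Fin M, jumpProb Q (α j) (α (j + 1)) =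
          Q (α j) (α (j + 1)) / -Q (α j) (α j) := fun j => if_neg (hne j)
      have h := measure_pathEvent_inter_lt hZ (fun j hj => (hα ⟨j, hj⟩).2) h0 s
      simp only [e] at h
      rw [← h]
      congr 1
      ext ω
      simp
  rw [← withDensity_apply _ hB, ← key, Measure.map_apply hH hB,
    Measure.restrict_apply (hH hB), Set.inter_comm]
  rfl

end law

/-! ### Non-explosion -/

lemma sum_sgn (f : ℤ → ℝ) (q : ℕ) (u : ℤ) :
    ∑ e : Bool, rateZ q u (u + sgn e) * f (u + sgn e) =
      (q : ℝ) ^ (-u) * f (u + 1) + (q : ℝ) ^ u * f (u - 1) := by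
  have h1 : u + sgn true = u + 1 := rfl
  have h2 : u + sgn false = u - 1 := rfl
  rw [Fintype.sum_bool, h1, h2, rateZ, if_pos rfl, rateZ, if_neg (by omega), if_pos rfl]

/-- The function `exitRate` is a Lyapunov function for the chain: discounted at rate `q`, its
expectation drops by at least `1 / (1 + q)` with each jump. -/
lemma sum_rateZ_mul_exitRate_le {q : ℕ} (hq : 2 ≤ q) (u : ℤ) :
    ∑ e : Bool, rateZ q u (u + sgn e) / (exitRate q u + q) * exitRate q (u + sgn e) ≤
      exitRate q u - 1 / (1 + q) := by
  have hq' : (2 : ℝ) ≤ q := by exact_mod_cast hq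
  have hq0 : (q : ℝ) ≠ 0 := by linarith
  have hpos := exitRate_pos hq u
  have h1 : ∑ e : Bool, rateZ q u (u + sgn e) / (exitRate q u + q) * exitRate q (u + sgn e) =
      ((q : ℝ) ^ (-u) * exitRate q (u + 1) + (q : ℝ) ^ u * exitRate q (u - 1)) /
        (exitRate q u + q) := by
    rw [← sum_sgn, Finset.sum_div]
    exact Finset.sum_congr rfl fun e _ => by ring
  have h2 : exitRate q (u + 1) = (q : ℝ) ^ u * q + (q : ℝ) ^ (-u) / q := by
    rw [exitRate, zpow_add₀ hq0, neg_add, zpow_add₀ hq0, zpow_neg_one, zpow_one, div_eq_mul_inv]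
  have h3 : exitRate q (u - 1) = (q : ℝ) ^ u / q + (q : ℝ) ^ (-u) * q := by
    rw [exitRate, sub_eq_add_neg, zpow_add₀ hq0, neg_add, zpow_add₀ hq0, zpow_neg_one, neg_neg,
      zpow_one, div_eq_mul_inv]
  have hxy : (q : ℝ) ^ u * (q : ℝ) ^ (-u) = 1 := by
    rw [← zpow_add₀ hq0, add_neg_cancel, zpow_zero]
  rw [h1, h2, h3, div_le_iff₀ (by positivity)]
  rw [exitRate] at hpos ⊢
  have hx : 0 < (q : ℝ) ^ u := by positivity
  have hy : 0 < (q : ℝ) ^ (-u) := by positivity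
  set x := (q : ℝ) ^ u
  set y := (q : ℝ) ^ (-u)
  set s := x + y with hs
  have hs2 : 2 ≤ s := by nlinarith [sq_nonneg (x - y)]
  have h4 : y * (x * q + y / q) + x * (x / q + y * q) = 2 * q + (s ^ 2 - 2) / q := by
    field_simp
    linear_combination (2 * (q : ℝ) ^ 2 - 2) * hxy
  have h5 : (s ^ 2 - 2) / q ≤ (s ^ 2 - 2) / 2 :=
    div_le_div_of_nonneg_left (by nlinarith) (by norm_num) hq'
  have h6 : (s + q) / (1 + q) ≤ s := by
    rw [div_le_iff₀ (by positivity)]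
    nlinarith
  have h7 : (s - 1 / (1 + q)) * (s + q) = s ^ 2 + q * s - (s + q) / (1 + q) := by ring
  rw [h4, h7]
  nlinarith

/-- Sums over paths, decomposed at the last jump. -/
lemma sum_walk_succ (w : ℤ → ℤ → ℝ) (f : ℤ → ℝ) (a : ℤ) (M : ℕ) :
    ∑ ε : Fin (M + 1) → Bool, (∏ j : Fin (M + 1), w (walk a ε j) (walk a ε (j + 1))) *
        f (walk a ε (M + 1)) =
      ∑ ε : Fin M → Bool, (∏ j : Fin M, w (walk a ε j) (walk a ε (j + 1))) *
        ∑ e : Bool, w (walk a ε M) (walk a ε M + sgn e) * f (walk a ε M + sgn e) := by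
  rw [← (Fin.snocEquiv fun _ : Fin (M + 1) => Bool).sum_comp, Fintype.sum_prod_type_right]
  refine Finset.sum_congr rfl fun ε _ => ?_
  rw [Finset.mul_sum]
  refine Finset.sum_congr rfl fun e _ => ?_
  have h1 : (Fin.snocEquiv fun _ : Fin (M + 1) => Bool) (e, ε) =
      (Fin.snoc ε e : Fin (M + 1) → Bool) := rfl
  rw [h1, walk_snoc_succ, Fin.prod_univ_castSucc, Fin.val_last, walk_snoc a ε e le_rfl,
    walk_snoc_succ, mul_assoc]
  congr 1
  refine Finset.prod_congr rfl fun j _ => ?_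
  rw [Fin.val_castSucc, walk_snoc a ε e j.2.le, walk_snoc a ε e j.2]

lemma sum_prod_jumpProb {q : ℕ} (hq : 2 ≤ q) (a : ℤ) (M : ℕ) :
    ∑ ε : Fin M → Bool, ∏ j : Fin M, jumpProb (rateZ q) (walk a ε j) (walk a ε (j + 1)) = 1 := by
  induction M with
  | zero => simp
  | succ M ih =>
    have h := sum_walk_succ (jumpProb (rateZ q)) (fun _ => 1) a M
    simp only [mul_one] at h
    rw [h, ← ih]
    refine Finset.sum_congr rfl fun ε _ => ?_
    have h1 : ∑ e : Bool, jumpProb (rateZ q) (walk a ε M) (walk a ε M + sgn e) = 1 := by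
      generalize walk a ε M = u
      have h2 : ∀ e, jumpProb (rateZ q) u (u + sgn e) = rateZ q u (u + sgn e) / exitRate q u :=
        fun e => by
          rw [jumpProb, if_neg (by have := sgn_ne_zero e; omega), rateZ_self, neg_neg]
      have h3 := sum_sgn (fun _ => 1) q u
      simp only [mul_one] at h3
      simp_rw [h2]
      rw [← Finset.sum_div, h3, add_comm]
      exact div_self (exitRate_pos hq u).ne'
    rw [h1, mul_one]

/-- The Laplace transform at `q` of the time of the `M`-th jump of the chain started in `a`, as a
sum over the signs of the jumps: a holding time with rate `l` contributes the factor
`l / (l + q)`, in which `l` times the jump probability is the rate of the jump. -/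
noncomputable def jumpLaplace (q : ℕ) (a : ℤ) (M : ℕ) : ℝ :=
  ∑ ε : Fin M → Bool, ∏ j : Fin M,
    (rateZ q (walk a ε j) (walk a ε (j + 1)) / (exitRate q (walk a ε j) + q))

lemma prod_rateZ_div_nonneg {q : ℕ} (hq : 2 ≤ q) (a : ℤ) {M : ℕ} (ε : Fin M → Bool) :
    0 ≤ ∏ j : Fin M,
      (rateZ q (walk a ε j) (walk a ε (j + 1)) / (exitRate q (walk a ε j) + q)) :=
  Finset.prod_nonneg fun j _ => div_nonneg (rateZ_nonneg_of_adj (walk_adj a ε j))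
    (add_nonneg (exitRate_pos hq _).le (Nat.cast_nonneg q))

/-- The chain does not explode: by the Lyapunov function, the expected discounted number of jumps
is finite. -/
lemma tendsto_jumpLaplace {q : ℕ} (hq : 2 ≤ q) (a : ℤ) :
    Tendsto (jumpLaplace q a) atTop (𝓝 0) := by
  set V : ℕ → ℝ := fun M => ∑ ε : Fin M → Bool, (∏ j : Fin M,
    (rateZ q (walk a ε j) (walk a ε (j + 1)) / (exitRate q (walk a ε j) + q))) *
      exitRate q (walk a ε M) with hV
  have hV0 : ∀ M, 0 ≤ V M := fun M => Finset.sum_nonneg fun ε _ =>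
    mul_nonneg (prod_rateZ_div_nonneg hq a ε) (exitRate_pos hq _).le
  have hstep : ∀ M, V (M + 1) ≤ V M - 1 / (1 + q) * jumpLaplace q a M := by
    intro M
    rw [hV]
    simp only
    rw [sum_walk_succ (fun u v => rateZ q u v / (exitRate q u + q)), jumpLaplace, Finset.mul_sum,
      ← Finset.sum_sub_distrib]
    refine Finset.sum_le_sum fun ε _ => ?_
    rw [mul_comm (1 / (1 + (q : ℝ))), ← mul_sub]
    exact mul_le_mul_of_nonneg_left (sum_rateZ_mul_exitRate_le hq _)
      (prod_rateZ_div_nonneg hq a ε)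
  have hnn : ∀ M, 0 ≤ jumpLaplace q a M := fun M =>
    Finset.sum_nonneg fun ε _ => prod_rateZ_div_nonneg hq a ε
  have hsum : ∀ N, 1 / (1 + q) * ∑ M ∈ Finset.range N, jumpLaplace q a M + V N ≤ V 0 := by
    intro N
    induction N with
    | zero => simp
    | succ N ih =>
      rw [Finset.sum_range_succ, mul_add]
      linarith [hstep N]
  refine (summable_of_sum_range_le (c := (1 + q) * V 0) hnn fun N => ?_).tendsto_atTop_zero
  have h1 := hsum N
  have h2 := hV0 N
  have hq0 : (0 : ℝ) < 1 + q := by positivity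
  have h3 : 1 / (1 + (q : ℝ)) * ∑ M ∈ Finset.range N, jumpLaplace q a M ≤ V 0 := by linarith
  rwa [one_div, ← div_eq_inv_mul, div_le_iff₀' hq0] at h3

/-! ### The finite dimensional distributions of the limit -/

section limit

variable {q : ℕ} {Ω : Type*} [MeasurableSpace Ω] {ν : Measure Ω} [IsProbabilityMeasure ν]
  {Z : ℝ≥0 → Ω → ℤ}

lemma walk_rateZ {q : ℕ} (hq : 2 ≤ q) (a : ℤ) {M : ℕ} (ε : Fin M → Bool) (j : Fin M) :
    0 ≤ rateZ q (walk a ε j) (walk a ε (j + 1)) ∧ rateZ q (walk a ε j) (walk a ε j) < 0 := by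
  refine ⟨rateZ_nonneg_of_adj (walk_adj a ε j), ?_⟩
  rw [rateZ_self]
  exact neg_neg_of_pos (exitRate_pos hq _)

/-- Almost surely, the first `M` jumps follow a nearest neighbour path. -/
lemma measure_compl_iUnion_pathEvent (hq : 2 ≤ q)
    (hZ : IsContinuousTimeMarkovChain (rateZ q) ν Z) {a : ℤ} (h0 : ∀ᵐ ω ∂ν, Z 0 ω = a) (M : ℕ) :
    ν (⋃ ε : Fin M → Bool, pathEvent Z M (walk a ε))ᶜ = 0 := by
  have hmeas : ∀ ε : Fin M → Bool, MeasurableSet (pathEvent Z M (walk a ε)) := fun ε =>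
    measurableSet_pathEvent hZ M _
  rw [prob_compl_eq_zero_iff (MeasurableSet.iUnion hmeas)]
  have hdisj : Pairwise (Function.onFun Disjoint
      fun ε : Fin M → Bool => pathEvent Z M (walk a ε)) := by
    intro ε ε' hne
    refine Set.disjoint_left.2 fun ω hω hω' => hne (funext fun j => sgn_injective ?_)
    have h : ∀ j ≤ M, walk a ε j = walk a ε' j := fun j hj =>
      (hω.1 j hj).symm.trans (hω'.1 j hj)
    have h2 := h (j + 1) j.2
    rw [walk_succ, walk_succ, h j j.2.le] at h2
    exact add_left_cancel h2
  refine le_antisymm prob_le_one ?_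
  rw [measure_iUnion hdisj hmeas, tsum_fintype]
  calc (1 : ℝ≥0∞) = ENNReal.ofReal (∑ ε : Fin M → Bool,
        ∏ j : Fin M, jumpProb (rateZ q) (walk a ε j) (walk a ε (j + 1))) := by
        rw [sum_prod_jumpProb hq, ENNReal.ofReal_one]
    _ ≤ ∑ ε : Fin M → Bool, ENNReal.ofReal
        (∏ j : Fin M, jumpProb (rateZ q) (walk a ε j) (walk a ε (j + 1))) :=
        Finset.le_sum_of_subadditive _ ENNReal.ofReal_zero.le
          (fun _ _ => ENNReal.ofReal_add_le) _ _
    _ ≤ _ := by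
        refine Finset.sum_le_sum fun ε _ => ?_
        have h := measure_pathEvent_inter_lt hZ (M := M) (α := walk a ε)
          (fun j hj => (walk_rateZ hq a ε ⟨j, hj⟩).2) (by simpa using h0) (fun _ => 0)
        simp only [Real.toNNReal_zero, NNReal.coe_zero, mul_zero, Real.exp_zero, mul_one] at h
        rw [← h]
        exact measure_mono fun ω hω => hω.1

/-- On a given path, the process has the prescribed values only if the holding times lie in
`readOut`, up to null sets and the event that the last jump occurs early. -/
lemma measure_inter_pathEvent_le (hq : 2 ≤ q)
    (hZ : IsContinuousTimeMarkovChain (rateZ q) ν Z) {a : ℤ} (h0 : ∀ᵐ ω ∂ν, Z 0 ω = a)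
    {k : ℕ} {t : Fin k → ℝ≥0} (ht0 : ∀ i, 0 < t i) (b : Fin k → ℤ) {T : ℝ}
    (hT : ∀ i, (t i : ℝ) ≤ T) {M : ℕ} (ε : Fin M → Bool) :
    ν ({ω | ∀ i, Z (t i) ω = b i} ∩ pathEvent Z M (walk a ε)) ≤
      (∫⁻ h in readOut (walk a ε) t b, pathDensity (M := M) (rateZ q) (walk a ε) h) +
      ∫⁻ h in {h : Fin M → ℝ | psum h M ≤ T}, pathDensity (rateZ q) (walk a ε) h := by
  -- the null set of holding times for which a jump occurs at one of the times `t i`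
  set N : Set (Fin M → ℝ) := ⋃ i : Fin k, ⋃ j : Fin (M + 1), {h | psum h j = t i} with hN
  have hNm : MeasurableSet N := MeasurableSet.iUnion fun i => MeasurableSet.iUnion fun j =>
    (isClosed_eq (continuous_psum _) continuous_const).measurableSet
  have hN0 : volume N = 0 := by
    simp only [hN, measure_iUnion_null_iff]
    exact fun i j => volume_psum_eq j (by omega) (by exact_mod_cast ht0 i)
  have hUm : MeasurableSet (readOut (M := M) (walk a ε) t b) := (isOpen_readOut _ _ _).measurableSet
  have hSm : MeasurableSet {h : Fin M → ℝ | psum h M ≤ T} :=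
    (isClosed_le (continuous_psum M) continuous_const).measurableSet
  have key := measure_pathEvent_inter hZ (M := M) (α := walk a ε) (walk_rateZ hq a ε)
    (walk_ne_succ a ε) (by simpa using h0) ((hUm.union hSm).union hNm)
  calc _ ≤ ν {ω | ω ∈ pathEvent Z M (walk a ε) ∧ (fun j : Fin M => holdingTime Z j ω) ∈
        readOut (walk a ε) t b ∪ {h : Fin M → ℝ | psum h M ≤ T} ∪ N} := by
        refine measure_mono fun ω ⟨hω, hωp⟩ => ⟨hωp, ?_⟩
        have hω : ∀ i, Z (t i) ω = b i := hω
        by_cases hωN : (fun j : Fin M => holdingTime Z j ω) ∈ N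
        · exact Or.inr hωN
        refine Or.inl ?_
        by_cases hωT : psum (fun j : Fin M => holdingTime Z j ω) M ≤ T
        · exact Or.inr hωT
        refine Or.inl fun i => ?_
        simp only [hN, Set.mem_iUnion, not_exists] at hωN
        have hTj : ∀ j : ℕ, j ≤ M → jumpTime Z j ω =
            ENNReal.ofReal (psum (fun j : Fin M => holdingTime Z j ω) j) := fun j hj => by
          rw [← jumpTime_eq_psum hωp hj, ENNReal.ofReal_toReal (jumpTime_lt_top hωp hj).ne]
        have hti : ((t i : ℝ≥0) : ℝ≥0∞) = ENNReal.ofReal (t i) := by simp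
        have hlt : ((t i : ℝ≥0) : ℝ≥0∞) < jumpTime Z M ω := by
          rw [hTj M le_rfl, hti, ENNReal.ofReal_lt_ofReal_iff_of_nonneg (t i).coe_nonneg]
          exact (hT i).trans_lt (not_le.1 hωT)
        obtain ⟨j, h1, h2⟩ := exists_jumpTime_le_lt hlt
        refine ⟨j, ?_, ?_, ?_⟩
        · have hne : psum (fun j : Fin M => holdingTime Z j ω) j ≠ t i := hωN i j.castSucc
          rw [hTj j j.2.le, hti, ENNReal.ofReal_le_ofReal_iff (t i).coe_nonneg] at h1
          exact lt_of_le_of_ne h1 hne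
        · rwa [hTj (j + 1) j.2, hti, ENNReal.ofReal_lt_ofReal_iff_of_nonneg (t i).coe_nonneg] at h2
        · rw [← hω i, eq_embedded h1 h2, hωp.1 j j.2.le]
    _ = _ := key
    _ ≤ _ := by
        refine (lintegral_union_le _ _ _).trans ?_
        rw [setLIntegral_measure_zero _ _ hN0, add_zero]
        exact lintegral_union_le _ _ _

/-- Up to the probability of `M` early jumps, the asymptotic lower bound for the discrete chain is
an upper bound for the limit. -/
lemma measure_eq_le_sum_setLIntegral (hq : 2 ≤ q)
    (hZ : IsContinuousTimeMarkovChain (rateZ q) ν Z) {a : ℤ} (h0 : ∀ᵐ ω ∂ν, Z 0 ω = a)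
    {k : ℕ} {t : Fin k → ℝ≥0} (ht0 : ∀ i, 0 < t i) (b : Fin k → ℤ) {T : ℝ}
    (hT : ∀ i, (t i : ℝ) ≤ T) (M : ℕ) :
    ν {ω | ∀ i, Z (t i) ω = b i} ≤
      (∑ ε : Fin M → Bool, ∫⁻ h in readOut (walk a ε) t b,
        pathDensity (M := M) (rateZ q) (walk a ε) h) +
      ENNReal.ofReal (Real.exp (q * T) * jumpLaplace q a M) := by
  set B := {ω | ∀ i, Z (t i) ω = b i}
  calc ν B ≤ ν (B ∩ ⋃ ε : Fin M → Bool, pathEvent Z M (walk a ε)) +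
        ν (⋃ ε : Fin M → Bool, pathEvent Z M (walk a ε))ᶜ := by
        refine (measure_mono fun ω hω => ?_).trans (measure_union_le _ _)
        by_cases h : ω ∈ ⋃ ε : Fin M → Bool, pathEvent Z M (walk a ε)
        · exact Or.inl ⟨hω, h⟩
        · exact Or.inr h
    _ = ν (⋃ ε : Fin M → Bool, B ∩ pathEvent Z M (walk a ε)) := by
        rw [measure_compl_iUnion_pathEvent hq hZ h0, add_zero, Set.inter_iUnion]
    _ ≤ ∑ ε : Fin M → Bool, ν (B ∩ pathEvent Z M (walk a ε)) := measure_iUnion_fintype_le _ _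
    _ ≤ ∑ ε : Fin M → Bool, ((∫⁻ h in readOut (walk a ε) t b,
          pathDensity (M := M) (rateZ q) (walk a ε) h) +
        ENNReal.ofReal (Real.exp (q * T) * ∏ j : Fin M,
          (rateZ q (walk a ε j) (walk a ε (j + 1)) / (exitRate q (walk a ε j) + q)))) := by
        refine Finset.sum_le_sum fun ε _ =>
          (measure_inter_pathEvent_le hq hZ h0 ht0 b hT ε).trans (add_le_add le_rfl ?_)
        have h := setLIntegral_pathDensity_psum_le (rateZ q) (M := M) (walk a ε)
          (walk_rateZ hq a ε) (Nat.cast_nonneg q) T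
        simpa only [rateZ_self, neg_neg] using h
    _ = _ := by
        rw [Finset.sum_add_distrib, jumpLaplace, Finset.mul_sum,
          ENNReal.ofReal_sum_of_nonneg fun ε _ =>
            mul_nonneg (Real.exp_pos _).le (prod_rateZ_div_nonneg hq a ε)]

end limit

/-! ### Total variation distance -/

/-- Scheffé's lemma: a pointwise asymptotic lower bound by a probability measure on a countable
space implies convergence in total variation. -/
lemma tendsto_tvDist_of_le_liminf {β : Type*} [MeasurableSpace β] [MeasurableSingletonClass β]
    [Countable β] (P : ℕ → Measure β) [∀ m, IsProbabilityMeasure (P m)] (R : Measure β)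
    [IsProbabilityMeasure R] (h : ∀ b, R {b} ≤ liminf (fun m => P m {b}) atTop) :
    Tendsto (fun m => tvDist (P m) R) atTop (𝓝 0) := by
  -- `d m` is the total mass by which `P m` falls short of `R` (truncated subtraction in `ℝ≥0∞`)
  set d : ℕ → ℝ≥0∞ := fun m => ∫⁻ b, (R {b} - P m {b}) ∂Measure.count with hd
  have hR : ∫⁻ b, R {b} ∂Measure.count = 1 := by
    rw [lintegral_count]
    have := Measure.tsum_indicator_apply_singleton R Set.univ MeasurableSet.univ
    simpa using this
  have hd0 : Tendsto d atTop (𝓝 0) := by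
    have hpt : ∀ b, Tendsto (fun m => R {b} - P m {b}) atTop (𝓝 0) := by
      intro b
      refine ENNReal.tendsto_nhds_zero.2 fun η hη => ?_
      by_cases hb : R {b} = 0
      · simp [hb]
      have h1 : R {b} - η < liminf (fun m => P m {b}) atTop :=
        (ENNReal.sub_lt_self (measure_ne_top R _) hb hη.ne').trans_le (h b)
      filter_upwards [eventually_lt_of_lt_liminf h1] with m hm
      rw [tsub_le_iff_left, ← tsub_le_iff_right]
      exact hm.le
    have := tendsto_lintegral_of_dominated_convergence (μ := Measure.count)
      (F := fun m b => R {b} - P m {b}) (f := fun _ => 0) (fun b => R {b})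
      (fun m => measurable_of_countable _) (fun m => Eventually.of_forall fun b => tsub_le_self)
      (by rw [hR]; exact ENNReal.one_ne_top) (Eventually.of_forall hpt)
    simpa using this
  have hle : ∀ m (A : Set β), MeasurableSet A → R A ≤ P m A + d m := by
    intro m A hA
    rw [← Measure.tsum_indicator_apply_singleton R A hA,
      ← Measure.tsum_indicator_apply_singleton (P m) A hA, hd]
    simp only
    rw [lintegral_count, ← ENNReal.tsum_add]
    refine ENNReal.tsum_le_tsum fun b => ?_
    by_cases hb : b ∈ A
    · simp only [Set.indicator_of_mem hb]
      exact le_add_tsub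
    · simp [Set.indicator_of_notMem hb]
  have hfin : ∀ m, d m ≠ ⊤ := fun m =>
    ne_top_of_le_ne_top (hR ▸ ENNReal.one_ne_top) (lintegral_mono fun b => tsub_le_self)
  have hreal : ∀ m (A : Set β), MeasurableSet A → R.real A - (P m).real A ≤ (d m).toReal := by
    intro m A hA
    have := ENNReal.toReal_mono (ENNReal.add_ne_top.2 ⟨measure_ne_top _ _, hfin m⟩) (hle m A hA)
    rw [ENNReal.toReal_add (measure_ne_top _ _) (hfin m)] at this
    rw [measureReal_def, measureReal_def]
    linarith
  have habs : ∀ m (A : {A : Set β // MeasurableSet A}),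
      |(P m).real A.1 - R.real A.1| ≤ (d m).toReal := by
    rintro m ⟨A, hA⟩
    -- the opposite inequality follows by passing to complements
    have h1 := hreal m A hA
    have h2 := hreal m Aᶜ hA.compl
    rw [probReal_compl_eq_one_sub hA, probReal_compl_eq_one_sub hA] at h2
    rw [abs_le]
    constructor <;> simp only <;> linarith
  have hdr : Tendsto (fun m => (d m).toReal) atTop (𝓝 0) := by
    simpa [Function.comp_def] using (ENNReal.tendsto_toReal ENNReal.zero_ne_top).comp hd0
  have : Nonempty {A : Set β // MeasurableSet A} := ⟨⟨∅, MeasurableSet.empty⟩⟩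
  exact squeeze_zero (fun m => Real.iSup_nonneg fun A => abs_nonneg _)
    (fun m => ciSup_le (habs m)) hdr

end RankEvolution

theorem mainTheorem8 (q : ℕ) (hq : IsPrimePow q)
    {Ω : ℕ → Type*} [∀ m, MeasurableSpace (Ω m)]
    (μ : ∀ m, Measure (Ω m)) [∀ m, IsProbabilityMeasure (μ m)]
    (X : ∀ m, ℕ → Ω m → Fin (2 * m + 1))
    (hX : ∀ m, RankEvolution.IsMarkovChain (RankEvolution.transP q (2 * m)) (μ m) (X m))
    {Ω' : Type*} [MeasurableSpace Ω'] (ν : Measure Ω') [IsProbabilityMeasure ν]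
    (Z : ℝ≥0 → Ω' → ℤ)
    (hZ : RankEvolution.IsContinuousTimeMarkovChain (RankEvolution.rateZ q) ν Z)
    (a : ℤ) (hZ0 : ∀ᵐ ω ∂ν, Z 0 ω = a)
    (hY0 : ∀ᶠ m in atTop, ∀ᵐ ω ∂(μ m), RankEvolution.rescaled q m (X m) 0 ω = a)
    (k : ℕ) (t : Fin k → ℝ≥0) (ht0 : ∀ i, 0 < t i) (ht : StrictMono t) :
    Tendsto
      (fun m : ℕ => RankEvolution.tvDist
        ((μ m).map (fun ω (i : Fin k) => RankEvolution.rescaled q m (X m) (t i) ω))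
        (ν.map (fun ω (i : Fin k) => Z (t i) ω)))
      atTop (𝓝 0) := by
  have hq2 : 2 ≤ q := hq.two_le
  have hYm : ∀ m, Measurable fun ω (i : Fin k) =>
      RankEvolution.rescaled q m (X m) (t i) ω := fun m =>
    measurable_pi_lambda _ fun i => by
      unfold RankEvolution.rescaled
      exact (measurable_of_countable fun x : Fin (2 * m + 1) => ((x : ℕ) : ℤ) - (m : ℤ)).comp
        ((hX m).measurable _)
  have hZm : Measurable fun ω (i : Fin k) => Z (t i) ω :=
    measurable_pi_lambda _ fun i => hZ.measurable (t i)
  have (m : ℕ) : IsProbabilityMeasure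
      ((μ m).map (fun ω (i : Fin k) => RankEvolution.rescaled q m (X m) (t i) ω)) :=
    Measure.isProbabilityMeasure_map (hYm m).aemeasurable
  have : IsProbabilityMeasure (ν.map (fun ω (i : Fin k) => Z (t i) ω)) :=
    Measure.isProbabilityMeasure_map hZm.aemeasurable
  obtain ⟨T, hT⟩ : ∃ T : ℝ, ∀ i, (t i : ℝ) ≤ T :=
    ⟨∑ i, (t i : ℝ), fun i => Finset.single_le_sum (f := fun i => (t i : ℝ))
      (fun j _ => (t j).2) (Finset.mem_univ i)⟩
  refine RankEvolution.tendsto_tvDist_of_le_liminf _ _ fun b => ?_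
  have e1 : ν.map (fun ω (i : Fin k) => Z (t i) ω) {b} = ν {ω | ∀ i, Z (t i) ω = b i} := by
    rw [Measure.map_apply hZm (measurableSet_singleton b)]
    congr 1
    ext ω
    simp [funext_iff]
  have e2 : ∀ m, (μ m).map (fun ω (i : Fin k) => RankEvolution.rescaled q m (X m) (t i) ω) {b} =
      μ m {ω | ∀ i, RankEvolution.rescaled q m (X m) (t i) ω = b i} := fun m => by
    rw [Measure.map_apply (hYm m) (measurableSet_singleton b)]
    congr 1
    ext ω
    simp [funext_iff]
  simp_rw [e1, e2]
  have hbound : ∀ M : ℕ, ν {ω | ∀ i, Z (t i) ω = b i} ≤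
      liminf (fun m => μ m {ω | ∀ i, RankEvolution.rescaled q m (X m) (t i) ω = b i}) atTop +
        ENNReal.ofReal (Real.exp (q * T) * RankEvolution.jumpLaplace q a M) := fun M =>
    (RankEvolution.measure_eq_le_sum_setLIntegral hq2 hZ hZ0 ht0 b hT M).trans
      (add_le_add (RankEvolution.sum_setLIntegral_pathDensity_le_liminf hq2 μ hX hY0 t b M) le_rfl)
  have hlim : Tendsto (fun M => ENNReal.ofReal
      (Real.exp (q * T) * RankEvolution.jumpLaplace q a M)) atTop (𝓝 0) := by
    have := (RankEvolution.tendsto_jumpLaplace hq2 a).const_mul (Real.exp (q * T))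
    rw [mul_zero] at this
    simpa [Function.comp_def] using (ENNReal.continuous_ofReal.tendsto 0).comp this
  simpa using ge_of_tendsto' (hlim.const_add _) hbound
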